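/- For a countable subset $\Delta\subset\mathbb{R}$ that is dense, let $\mathbb{R}_\Delta=(\mathbb{R}\setminus\Delta)\sqcup\{t_+,t_-\mid t\in\Delta\}$, totally ordered so that the order of the underlying real numbers is respected and $t_-<t_+$ for $t\in\Delta$, with the order topology. For real $\lambda>1$ put $\Gamma_\lambda=\mathbb{Z}[\lambda,\lambda^{-1}]$ and $\langle\lambda\rangle=\{\lambda^k\mid k\in\mathbb{Z}\}$. The group $\Gamma_\lambda\rtimes\langle\lambda\rangle$ acts on $\mathbb{R}_\lambda:=\mathbb{R}_{\Gamma_\lambda}$ by the maps induced from $x\mapsto lx+s$ ($l\in\langle\lambda\rangle$, $s\in\Gamma_\lambda$). Let $\mathcal{S}_\lambda=\mathbb{R}_\lambda\rtimes(\Gamma_\lambda\rtimes\langle\lambda\rangle)$ be the transformation groupoid (the group being discrete), with unit space $\mathbb{R}_\lambda$, and let $\mathcal{S}_\lambda|[0_+,1_-]$ be the subgroupoid of all elements whose range and source lie in $[0_+,1_-]\subset\mathbb{R}_\lambda$. Let $V_{\lambda,1}$ be the group of right continuous piecewise linear bijections of $[0,1)$ with finitely many breakpoints, all in $\Gamma_\lambda$,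 and slopes in $\langle\lambda\rangle$, and let $F_{\lambda,1}\subset V_{\lambda,1}$ be the subgroup of order preserving maps. Let $\beta=(\sqrt5+1)/2$. There is a continuous groupoid homomorphism $\Phi:\mathcal{S}_2|[0_+,1_-]\to\mathcal{S}_\beta|[0_+,1_-]$ such that 1. $\Phi$ is injective and open; 2. $\Phi$ restricts to a homeomorphism $\varphi$ from $\mathbb{R}_2\cap[0_+,1_-]$ onto $\mathbb{R}_\beta\cap[0_+,1_-]$ that preserves the order, that is, $x<y$ if and only if $\varphi(x)<\varphi(y)$. Moreover, $\Phi$ extends to an injective open continuous groupoid homomorphism $\Psi:\mathcal{S}_2\to\mathcal{S}_\beta$ whose restriction to the unit spaces is a homeomorphism $\psi$ from $\mathbb{R}_2$ onto $\mathbb{R}_\beta$ that preserves the order in the same sense. There is an injective group homomorphism $\iota:V_{2,1}\to V_{\beta,1}$ that maps $F_{2,1}$ into $F_{\beta,1}$ and is induced by these maps in the following sense. For real $x$ let $\hat x$ denote the largest point over $x$ in $\mathbb{R}_2$, respectively in $\mathbb{R}_\beta$ (that is, $x_+$ if $x$ lies in $\Gamma_2$, respectively $\Gamma_\beta$, and $x$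 otherwise). If $f\in V_{2,1}$, $x,y\in[0,1)$ and $\psi(\hat x)=\hat y$, then $\psi(\widehat{f(x)})=\widehat{\iota(f)(y)}$. In particular $V_{2,1}$ embeds into $V_{\beta,1}$ and $F_{2,1}$ embeds into $F_{\beta,1}$. -/

import Mathlib

open Set Topology

namespace Stein

/-! ### Groupoids, given by their sets of arrows -/

/-- A groupoid presented by its set `𝒢` of arrows.  The source and range of an arrow are the units
`src g = g⁻¹ g` and `rng g = g g⁻¹`, and `comp g h` is defined when `src g = rng h`. -/
class ArrowGroupoid (𝒢 : Type*) where
  src : 𝒢 → 𝒢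
  rng : 𝒢 → 𝒢
  comp : ∀ g h : 𝒢, src g = rng h → 𝒢
  inv : 𝒢 → 𝒢
  src_src : ∀ g, src (src g) = src g
  rng_src : ∀ g, rng (src g) = src g
  src_rng : ∀ g, src (rng g) = rng g
  rng_rng : ∀ g, rng (rng g) = rng g
  src_comp : ∀ g h e, src (comp g h e) = src h
  rng_comp : ∀ g h e, rng (comp g h e) = rng g
  comp_assoc : ∀ g h k (e₁ : src g = rng h) (e₂ : src h = rng k),
    comp (comp g h e₁) k ((src_comp g h e₁).trans e₂)
      = comp g (comp h k e₂) (e₁.trans (rng_comp h k e₂).symm)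
  comp_src : ∀ g, comp g (src g) (rng_src g).symm = g
  rng_comp_self : ∀ g, comp (rng g) g (src_rng g) = g
  src_inv : ∀ g, src (inv g) = rng g
  rng_inv : ∀ g, rng (inv g) = src g
  comp_inv : ∀ g, comp g (inv g) (rng_inv g).symm = rng g
  inv_comp : ∀ g, comp (inv g) g (src_inv g) = src g

/-- Groupoid homomorphisms: composable pairs go to composable pairs, products to products. -/
def IsGroupoidHom {𝒢 ℋ : Type*} [ArrowGroupoid 𝒢] [ArrowGroupoid ℋ] (Φ : 𝒢 → ℋ) : Prop :=
  ∀ (g h : 𝒢) (e : ArrowGroupoid.src g = ArrowGroupoid.rng h),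
    ∃ e' : ArrowGroupoid.src (Φ g) = ArrowGroupoid.rng (Φ h),
      Φ (ArrowGroupoid.comp g h e) = ArrowGroupoid.comp (Φ g) (Φ h) e'

/-- Injective open continuous groupoid homomorphisms. -/
structure IsOpenGroupoidEmbedding {𝒢 ℋ : Type*} [ArrowGroupoid 𝒢] [TopologicalSpace 𝒢]
    [ArrowGroupoid ℋ] [TopologicalSpace ℋ] (Φ : 𝒢 → ℋ) : Prop where
  hom : IsGroupoidHom Φ
  continuous : Continuous Φ
  injective : Function.Injective Φ
  isOpenMap : IsOpenMap Φ

/-! ### Transformation groupoids and their reductions -/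

/-- The transformation groupoid `X ⋊ G` of an action of a discrete group `G` on `X`. -/
@[ext]
structure TransformationGroupoid (X G : Type*) where
  pt : X
  elt : G

namespace TransformationGroupoid

variable {X G : Type*}

/-- The product topology of `X × G`, where `G` is discrete. -/
instance [TopologicalSpace X] : TopologicalSpace (TransformationGroupoid X G) :=
  TopologicalSpace.induced (fun g => (g.pt, g.elt)) (@instTopologicalSpaceProd X G _ ⊥)

variable [Group G] [MulAction G X]

/-- The unit `(x, 1)` at the point `x`. -/
def unit (x : X) : TransformationGroupoid X G := ⟨x, 1⟩

/-- `r(x, γ) = (x, 1)`, `s(x, γ) = (γ⁻¹ x, 1)`, `(x, γ) (x', γ') = (x, γ γ')` and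
`(x, γ)⁻¹ = (γ⁻¹ x, γ⁻¹)`. -/
instance : ArrowGroupoid (TransformationGroupoid X G) where
  src g := unit (g.elt⁻¹ • g.pt)
  rng g := unit g.pt
  comp g h _ := ⟨g.pt, g.elt * h.elt⟩
  inv g := ⟨g.elt⁻¹ • g.pt, g.elt⁻¹⟩
  src_src g := by simp [unit]
  rng_src g := by simp [unit]
  src_rng g := by simp [unit]
  rng_rng g := by simp [unit]
  src_comp g h e := by
    have e' : g.elt⁻¹ • g.pt = h.pt := congrArg TransformationGroupoid.pt e
    simp [unit, mul_smul, e']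
  rng_comp _ _ _ := rfl
  comp_assoc g h k e₁ e₂ := by simp [mul_assoc]
  comp_src g := by simp [unit]
  rng_comp_self g := by simp [unit]
  src_inv g := by simp [unit]
  rng_inv g := by simp [unit]
  comp_inv g := by simp [unit]
  inv_comp g := by simp [unit]

/-- The reduction of `X ⋊ G` to a subset `Y` of the unit space `X`: the arrows whose range and
source both lie in `Y`. -/
def Reduction (G : Type*) [Group G] [MulAction G X] (Y : Set X) : Type _ :=
  {g : TransformationGroupoid X G // g.pt ∈ Y ∧ g.elt⁻¹ • g.pt ∈ Y}

namespace Reduction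

variable {Y : Set X}

instance [TopologicalSpace X] : TopologicalSpace (Reduction G Y) :=
  instTopologicalSpaceSubtype

/-- The unit of the reduction at a point of `Y`. -/
def unit (x : Y) : Reduction G Y :=
  ⟨TransformationGroupoid.unit (x : X), by simp [TransformationGroupoid.unit]⟩

/-- The reduction is a groupoid under the restricted operations. -/
instance : ArrowGroupoid (Reduction G Y) where
  src g := ⟨ArrowGroupoid.src g.1, by simpa [ArrowGroupoid.src, TransformationGroupoid.unit] using g.2.2⟩
  rng g := ⟨ArrowGroupoid.rng g.1, by simpa [ArrowGroupoid.rng, TransformationGroupoid.unit] using g.2.1⟩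
  comp g h e := ⟨ArrowGroupoid.comp g.1 h.1 (congrArg Subtype.val e), g.2.1, by
    have e' := congrArg TransformationGroupoid.pt
      (ArrowGroupoid.src_comp g.1 h.1 (congrArg Subtype.val e))
    change (ArrowGroupoid.comp g.1 h.1 _).elt⁻¹ • (ArrowGroupoid.comp g.1 h.1 _).pt
      = h.1.elt⁻¹ • h.1.pt at e'
    rw [e']
    exact h.2.2⟩
  inv g := ⟨ArrowGroupoid.inv g.1, g.2.2, by simpa [ArrowGroupoid.inv] using g.2.1⟩
  src_src g := Subtype.ext (ArrowGroupoid.src_src g.1)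
  rng_src g := Subtype.ext (ArrowGroupoid.rng_src g.1)
  src_rng g := Subtype.ext (ArrowGroupoid.src_rng g.1)
  rng_rng g := Subtype.ext (ArrowGroupoid.rng_rng g.1)
  src_comp g h e := Subtype.ext (ArrowGroupoid.src_comp g.1 h.1 (congrArg Subtype.val e))
  rng_comp g h e := Subtype.ext (ArrowGroupoid.rng_comp g.1 h.1 (congrArg Subtype.val e))
  comp_assoc g h k e₁ e₂ := Subtype.ext (ArrowGroupoid.comp_assoc g.1 h.1 k.1
    (congrArg Subtype.val e₁) (congrArg Subtype.val e₂))
  comp_src g := Subtype.ext (ArrowGroupoid.comp_src g.1)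
  rng_comp_self g := Subtype.ext (ArrowGroupoid.rng_comp_self g.1)
  src_inv g := Subtype.ext (ArrowGroupoid.src_inv g.1)
  rng_inv g := Subtype.ext (ArrowGroupoid.rng_inv g.1)
  comp_inv g := Subtype.ext (ArrowGroupoid.comp_inv g.1)
  inv_comp g := Subtype.ext (ArrowGroupoid.inv_comp g.1)

end Reduction

end TransformationGroupoid

/-! ### The real line with the points of `Δ` doubled -/

/-- The space `ℝ_Δ = (ℝ ∖ Δ) ⊔ {t₊, t₋ ∣ t ∈ Δ}`.  The point `x ∉ Δ` is encoded as `(x, 0)`, and for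
`t ∈ Δ` the points `t₋` and `t₊` are encoded as `(t, -1)` and `(t, 1)`. -/
def SplitReal (Δ : Set ℝ) : Type :=
  {p : ℝ ×ₗ SignType // (ofLex p).1 ∈ Δ ↔ (ofLex p).2 ≠ 0}

namespace SplitReal

variable {Δ : Set ℝ}

/-- The lexicographic order. -/
noncomputable instance : LinearOrder (SplitReal Δ) :=
  inferInstanceAs (LinearOrder {p : ℝ ×ₗ SignType // (ofLex p).1 ∈ Δ ↔ (ofLex p).2 ≠ 0})

noncomputable instance : TopologicalSpace (SplitReal Δ) := Preorder.topology (SplitReal Δ)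

instance : OrderTopology (SplitReal Δ) := ⟨rfl⟩

/-- The canonical surjection `q : ℝ_Δ → ℝ`. -/
def q (x : SplitReal Δ) : ℝ := (ofLex x.1).1

/-- `-1`, `0` or `1` according to whether `x` is `t₋`, a point outside `Δ`, or `t₊`. -/
def side (x : SplitReal Δ) : SignType := (ofLex x.1).2

/-- The point with given value and side. -/
def mk (t : ℝ) (σ : SignType) (h : t ∈ Δ ↔ σ ≠ 0) : SplitReal Δ := ⟨toLex (t, σ), h⟩

theorem mem_iff (x : SplitReal Δ) : x.q ∈ Δ ↔ x.side ≠ 0 := x.2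

@[ext]
theorem ext {x y : SplitReal Δ} (h₁ : x.q = y.q) (h₂ : x.side = y.side) : x = y :=
  Subtype.ext (ofLex.injective (Prod.ext h₁ h₂))

/-- The point `t₊`. -/
def plus (t : ℝ) (ht : t ∈ Δ) : SplitReal Δ := mk t 1 (by simp [ht])

/-- The point `t₋`. -/
def minus (t : ℝ) (ht : t ∈ Δ) : SplitReal Δ := mk t (-1) (by simp [ht])

open Classical in
/-- The largest point over a real number `t`: it is `t₊` if `t ∈ Δ` and `t` itself otherwise. -/
noncomputable def right (Δ : Set ℝ) (t : ℝ) : SplitReal Δ :=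
  mk t (if t ∈ Δ then 1 else 0) (by by_cases h : t ∈ Δ <;> simp [h])

end SplitReal

/-! ### Stein groupoids -/

/-- The multiplicative group `(0, ∞)`. -/
abbrev PosReal : Type := {x : ℝ // 0 < x}

/-- A pair `(Γ, Λ)` of a countable multiplicative subgroup `Λ` of `(0, ∞)` and a countable
`ℤΛ`-submodule `Γ` of `ℝ` that is dense in `ℝ`. -/
structure SteinPair where
  Γ : AddSubgroup ℝ
  Λ : Subgroup PosReal
  countable_Γ : (Γ : Set ℝ).Countable
  countable_Λ : (Λ : Set PosReal).Countable
  smul_mem : ∀ l ∈ Λ, ∀ t ∈ Γ, (l : ℝ) * t ∈ Γ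
  dense_Γ : Dense (Γ : Set ℝ)

namespace SteinPair

variable (D : SteinPair)

/-- The action of `Λ` on `Γ` by multiplication. -/
noncomputable def scale : D.Λ →* MulAut (Multiplicative D.Γ) where
  toFun l :=
    { toFun := fun t => Multiplicative.ofAdd
        ⟨(l.1 : ℝ) * (t.toAdd : ℝ), D.smul_mem l.1 l.2 _ t.toAdd.2⟩
      invFun := fun t => Multiplicative.ofAdd
        ⟨((l⁻¹ : D.Λ).1 : ℝ) * (t.toAdd : ℝ), D.smul_mem _ (l⁻¹ : D.Λ).2 _ t.toAdd.2⟩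
      left_inv := fun t => by
        apply Multiplicative.toAdd.injective
        apply Subtype.ext
        simpa using inv_mul_cancel_left₀ l.1.2.ne' (t.toAdd : ℝ)
      right_inv := fun t => by
        apply Multiplicative.toAdd.injective
        apply Subtype.ext
        simpa using mul_inv_cancel_left₀ l.1.2.ne' (t.toAdd : ℝ)
      map_mul' := fun t u => by
        apply Multiplicative.toAdd.injective
        apply Subtype.ext
        simp [mul_add] }
  map_one' := by
    ext t
    simp
  map_mul' l m := by
    ext t
    simp [mul_assoc]

/-- The semidirect product `Γ ⋊ Λ`. -/
abbrev Aff : Type := Multiplicative D.Γ ⋊[D.scale] D.Λ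

/-- The underlying set `ℝ_Γ` of the unit space. -/
abbrev Line : Type := SplitReal (D.Γ : Set ℝ)

theorem mul_add_mem_iff (l : D.Λ) (t : D.Γ) (x : ℝ) : (l.1 : ℝ) * x + t ∈ D.Γ ↔ x ∈ D.Γ := by
  constructor
  · intro h
    have h1 := D.smul_mem _ (l⁻¹ : D.Λ).2 _ (D.Γ.sub_mem h t.2)
    simpa [inv_mul_cancel_left₀ l.1.2.ne'] using h1
  · intro h
    exact D.Γ.add_mem (D.smul_mem _ l.2 _ h) t.2

/-- The action of `Γ ⋊ Λ` on `ℝ_Γ` induced by `(t, l) · x = l x + t`. -/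
noncomputable instance : MulAction D.Aff D.Line where
  smul g x := SplitReal.mk ((g.right.1 : ℝ) * x.q + (g.left.toAdd : D.Γ)) x.side
    ((D.mul_add_mem_iff g.right g.left.toAdd x.q).trans x.mem_iff)
  one_smul x := by
    apply SplitReal.ext
    · change ((1 : ℝ)) * x.q + 0 = x.q
      ring
    · rfl
  mul_smul g h x := by
    apply SplitReal.ext
    · change ((g.right.1 : ℝ) * (h.right.1 : ℝ)) * x.q
          + ((g.left.toAdd : ℝ) + (g.right.1 : ℝ) * (h.left.toAdd : ℝ))
        = (g.right.1 : ℝ) * ((h.right.1 : ℝ) * x.q + (h.left.toAdd : ℝ)) + (g.left.toAdd : ℝ)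
      ring
    · rfl

/-- The Stein groupoid `𝒮(Γ, Λ) = ℝ_Γ ⋊ (Γ ⋊ Λ)`. -/
abbrev Groupoid : Type := TransformationGroupoid D.Line D.Aff

/-- The compact open interval `[0₊, ℓ₋]` of `ℝ_Γ`. -/
def interval (ℓ : ℝ) (hℓ : ℓ ∈ D.Γ) : Set D.Line :=
  Icc (SplitReal.plus 0 D.Γ.zero_mem) (SplitReal.minus ℓ hℓ)

/-- The reduction `𝒮(Γ, Λ)|[0₊, ℓ₋]`. -/
abbrev Reduced (ℓ : ℝ) (hℓ : ℓ ∈ D.Γ) : Type :=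
  TransformationGroupoid.Reduction D.Aff (D.interval ℓ hℓ)

/-! ### Stein's groups -/

/-- `f` is a piecewise linear right continuous map of `[0, ℓ)`, with a finite set `B ⊆ Γ` of
breakpoints and slopes in `Λ`: on every `[a, b) ⊆ [0, ℓ)` with no breakpoint strictly between
`a` and `b`, it is of the form `t ↦ l t + s` with `l ∈ Λ`. -/
def IsPiecewise (ℓ : ℝ) (f : Ico (0 : ℝ) ℓ → Ico (0 : ℝ) ℓ) : Prop :=
  ∃ B : Set ℝ, B.Finite ∧ B ⊆ D.Γ ∧
    ∀ a b : ℝ, 0 ≤ a → a < b → b ≤ ℓ → Disjoint (Ioo a b) B →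
      ∃ l ∈ D.Λ, ∃ s : ℝ, ∀ t : Ico (0 : ℝ) ℓ, a ≤ t → (t : ℝ) < b → (f t : ℝ) = l * t + s

/-- Every point of `[0, ℓ)` lies in a maximal interval of linearity. -/
theorem exists_piece {Λ : Subgroup PosReal} {ℓ : ℝ} {f : Ico (0 : ℝ) ℓ → Ico (0 : ℝ) ℓ} {B : Set ℝ}
    (hB : B.Finite)
    (h : ∀ a b : ℝ, 0 ≤ a → a < b → b ≤ ℓ → Disjoint (Ioo a b) B →
      ∃ l ∈ Λ, ∃ s : ℝ, ∀ t : Ico (0 : ℝ) ℓ, a ≤ t → (t : ℝ) < b → (f t : ℝ) = l * t + s)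
    (x : Ico (0 : ℝ) ℓ) :
    ∃ a b : ℝ, 0 ≤ a ∧ a ≤ x ∧ x < b ∧ b ≤ ℓ ∧ a ∈ insert 0 B ∧ b ∈ insert ℓ B ∧
      Disjoint (Ioo a b) B ∧
      ∃ l ∈ Λ, ∃ s : ℝ, ∀ t : Ico (0 : ℝ) ℓ, a ≤ t → (t : ℝ) < b → (f t : ℝ) = l * t + s := by
  obtain ⟨a, ⟨haB, ha0, hax⟩, ha⟩ := Set.exists_max_image
    (insert 0 B ∩ Icc 0 (x : ℝ)) id ((hB.insert 0).inter_of_left _)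
    ⟨0, mem_insert _ _, le_rfl, x.2.1⟩
  obtain ⟨b, ⟨hbB, hxb, hbl⟩, hb⟩ := Set.exists_min_image
    (insert ℓ B ∩ Ioc (x : ℝ) ℓ) id ((hB.insert ℓ).inter_of_left _)
    ⟨ℓ, mem_insert _ _, x.2.2, le_rfl⟩
  have hd : Disjoint (Ioo a b) B := by
    rw [Set.disjoint_left]
    rintro c ⟨hac, hcb⟩ hc
    rcases le_or_gt c x with hcx | hcx
    · exact absurd (ha c ⟨mem_insert_of_mem _ hc, ha0.trans hac.le, hcx⟩) (not_le.2 hac)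
    · exact absurd (hb c ⟨mem_insert_of_mem _ hc, hcx, hcb.le.trans hbl⟩) (not_le.2 hcb)
  exact ⟨a, b, ha0, hax, hxb, hbl, haB, hbB, hd, h a b ha0 (hax.trans_lt hxb) hbl hd⟩

/-- The image of an interval of linearity stays below `ℓ`. -/
theorem image_le {ℓ : ℝ} {f : Ico (0 : ℝ) ℓ → Ico (0 : ℝ) ℓ} {a b l s : ℝ} (hl : 0 < l)
    (ha : 0 ≤ a) (hab : a < b) (hb : b ≤ ℓ)
    (h : ∀ t : Ico (0 : ℝ) ℓ, a ≤ t → (t : ℝ) < b → (f t : ℝ) = l * t + s) : l * b + s ≤ ℓ := by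
  by_contra hc
  push Not at hc
  have h1 : (ℓ - s) / l < b := by rw [div_lt_iff₀ hl]; linarith
  have ht : max a ((ℓ - s) / l) < b := max_lt hab h1
  have h2 := h ⟨max a ((ℓ - s) / l), ha.trans (le_max_left _ _), ht.trans_le hb⟩
    (le_max_left _ _) ht
  have h3 := (f ⟨max a ((ℓ - s) / l), ha.trans (le_max_left _ _), ht.trans_le hb⟩).2.2
  rw [h2] at h3
  have h4 : (ℓ - s) / l ≤ max a ((ℓ - s) / l) := le_max_right _ _
  rw [div_le_iff₀ hl] at h4
  simp only at h3
  linarith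

/-- The right end point of the image of a maximal interval of linearity of a bijection is the
value at a breakpoint, if it is not `ℓ`. -/
theorem image_end {Λ : Subgroup PosReal} {ℓ : ℝ} {f : Equiv.Perm (Ico (0 : ℝ) ℓ)} {B : Set ℝ}
    (hB : B.Finite)
    (h : ∀ a b : ℝ, 0 ≤ a → a < b → b ≤ ℓ → Disjoint (Ioo a b) B →
      ∃ l ∈ Λ, ∃ s : ℝ, ∀ t : Ico (0 : ℝ) ℓ, a ≤ t → (t : ℝ) < b → (f t : ℝ) = l * t + s)
    {a b l s : ℝ} (hl : 0 < l) (ha : 0 ≤ a) (hab : a < b) (hb : b ≤ ℓ) (hbB : b ∈ insert ℓ B)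
    (hf : ∀ t : Ico (0 : ℝ) ℓ, a ≤ t → (t : ℝ) < b → (f t : ℝ) = l * t + s) :
    l * b + s = ℓ ∨ ∃ z : Ico (0 : ℝ) ℓ, (z : ℝ) ∈ insert 0 B ∧ (f z : ℝ) = l * b + s := by
  have hle := image_le hl ha hab hb hf
  rcases hle.eq_or_lt with hlt | hlt
  · exact Or.inl hlt
  right
  have hfa := (f ⟨a, ha, hab.trans_le hb⟩).2.1
  rw [hf ⟨a, ha, hab.trans_le hb⟩ le_rfl hab] at hfa
  simp only at hfa
  have he : 0 ≤ l * b + s := by nlinarith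
  obtain ⟨z, hz⟩ := f.surjective ⟨l * b + s, he, hlt⟩
  have hz' : (f z : ℝ) = l * b + s := congrArg Subtype.val hz
  refine ⟨z, ?_, hz'⟩
  by_contra hzB
  obtain ⟨a', b', ha', haz, hzb, hb', haB', -, -, m, -, s', hf'⟩ := exists_piece hB h z
  have haz : a' < z := lt_of_le_of_ne haz (fun e => hzB (e ▸ haB'))
  have hm : (0 : ℝ) < m := m.2
  rw [hf' z haz.le hzb] at hz'
  have key : ∀ δ : ℝ, 0 < δ → δ ≤ l * (b - a) → δ ≤ m * (z - a') → z - δ / m = b - δ / l := by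
    intro δ hδ h1 h2
    have h1' : δ / l ≤ b - a := by rw [div_le_iff₀ hl]; linarith
    have h2' : δ / m ≤ z - a' := by rw [div_le_iff₀ hm]; linarith
    have p1 : 0 < δ / l := div_pos hδ hl
    have p2 : 0 < δ / m := div_pos hδ hm
    have e1 := hf ⟨b - δ / l, by linarith, by linarith⟩ (by simp only; linarith)
      (by simp only; linarith)
    have e2 := hf' ⟨z - δ / m, by linarith, by linarith⟩ (by simp only; linarith)
      (by simp only; linarith)
    have e3 : f ⟨z - δ / m, by linarith, by linarith⟩ = f ⟨b - δ / l, by linarith, by linarith⟩ := by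
      apply Subtype.ext
      rw [e1, e2]
      simp only
      have c1 : l * (δ / l) = δ := mul_div_cancel₀ _ hl.ne'
      have c2 : (m : ℝ) * (δ / m) = δ := mul_div_cancel₀ _ hm.ne'
      nlinarith
    exact congrArg Subtype.val (f.injective e3)
  have hδ : 0 < min (l * (b - a)) (m * (z - a')) :=
    lt_min (mul_pos hl (by linarith)) (mul_pos hm (by linarith))
  have k1 := key _ hδ (min_le_left _ _) (min_le_right _ _)
  have k2 := key _ (half_pos hδ) ((half_le_self hδ.le).trans (min_le_left _ _))
    ((half_le_self hδ.le).trans (min_le_right _ _))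
  have hzb : (z : ℝ) = b := by
    rw [div_right_comm, div_right_comm _ _ l] at k2
    linarith
  rcases hbB with hbB | hbB
  · exact absurd z.2.2 (by rw [hzb, hbB]; exact lt_irrefl _)
  · exact hzB (mem_insert_of_mem _ (hzb ▸ hbB))

/-- The values at the breakpoints lie in `Γ`. -/
theorem value_mem {ℓ : ℝ} (hℓ : ℓ ∈ D.Γ) {f : Equiv.Perm (Ico (0 : ℝ) ℓ)} {B : Set ℝ}
    (hB : B.Finite) (hBΓ : B ⊆ D.Γ)
    (h : ∀ a b : ℝ, 0 ≤ a → a < b → b ≤ ℓ → Disjoint (Ioo a b) B →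
      ∃ l ∈ D.Λ, ∃ s : ℝ, ∀ t : Ico (0 : ℝ) ℓ, a ≤ t → (t : ℝ) < b → (f t : ℝ) = l * t + s)
    (z : Ico (0 : ℝ) ℓ) (hz : (z : ℝ) ∈ insert 0 B) : (f z : ℝ) ∈ D.Γ := by
  have fin : {z : Ico (0 : ℝ) ℓ | (z : ℝ) ∈ insert 0 B}.Finite :=
    (hB.insert 0).preimage Subtype.val_injective.injOn
  have hBΓ0 : ∀ c ∈ insert 0 B, c ∈ D.Γ := by
    rintro c (rfl | hc)
    · exact D.Γ.zero_mem
    · exact hBΓ hc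
  by_contra hbad
  obtain ⟨y, ⟨hyB, hy⟩, hmin⟩ := Set.exists_min_image
    {z : Ico (0 : ℝ) ℓ | (z : ℝ) ∈ insert 0 B ∧ (f z : ℝ) ∉ D.Γ} (fun z => (f z : ℝ))
    (fin.subset fun z hz => hz.1) ⟨z, hz, hbad⟩
  have hy0 : 0 < (f y : ℝ) :=
    lt_of_le_of_ne (f y).2.1 (fun e => hy (e ▸ D.Γ.zero_mem))
  have hℓ0 : 0 < ℓ := y.2.1.trans_lt y.2.2
  obtain ⟨w, hw⟩ := f.surjective ⟨0, le_rfl, hℓ0⟩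
  have hw' : (f w : ℝ) = 0 := congrArg Subtype.val hw
  have hwB : (w : ℝ) ∈ insert 0 B := by
    by_contra hwB
    obtain ⟨a, b, ha, haw, hwb, hb, haB, -, -, l, -, s, hf⟩ := exists_piece hB h w
    have haw : a < w := lt_of_le_of_ne haw (fun e => hwB (e ▸ haB))
    have h1 := hf w haw.le hwb
    have h2 := hf ⟨a, ha, by linarith⟩ le_rfl (haw.trans hwb)
    have h3 := (f ⟨a, ha, by linarith⟩).2.1
    have hl : (0 : ℝ) < l := l.2
    simp only at h2 h3
    nlinarith
  obtain ⟨p, ⟨hpB, hpy⟩, hmax⟩ := Set.exists_max_image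
    {z : Ico (0 : ℝ) ℓ | (z : ℝ) ∈ insert 0 B ∧ (f z : ℝ) < f y} (fun z => (f z : ℝ))
    (fin.subset fun z hz => hz.1) ⟨w, hwB, hw'.trans_lt hy0⟩
  have hpΓ : (f p : ℝ) ∈ D.Γ := by
    by_contra hp
    exact absurd (hmin p ⟨hpB, hp⟩) (not_le.2 hpy)
  obtain ⟨a, b, ha, hap, hpb, hb, haB, hbB, hd, l, hlΛ, s, hf⟩ := exists_piece hB h p
  have hl : (0 : ℝ) < l := l.2
  have hbΓ : b ∈ D.Γ := by
    rcases hbB with rfl | hbB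
    · exact hℓ
    · exact hBΓ hbB
  have hfp := hf p hap hpb
  have heΓ : (l : ℝ) * b + s ∈ D.Γ := by
    have := D.Γ.add_mem hpΓ (D.smul_mem l hlΛ _ (D.Γ.sub_mem hbΓ (hBΓ0 _ hpB)))
    rw [hfp] at this
    convert this using 1
    ring
  have hye : (l : ℝ) * b + s ≤ f y := by
    by_contra hlt
    push Not at hlt
    have c1 : (l : ℝ) * (((f y : ℝ) - s) / l) = f y - s := mul_div_cancel₀ _ hl.ne'
    have t1 : (p : ℝ) < ((f y : ℝ) - s) / l := by rw [lt_div_iff₀ hl]; nlinarith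
    have t2 : ((f y : ℝ) - s) / l < b := by rw [div_lt_iff₀ hl]; nlinarith
    have t0 := p.2.1
    have e := hf ⟨((f y : ℝ) - s) / l, by linarith, by linarith⟩ (by simp only; linarith) t2
    have e2 : f ⟨((f y : ℝ) - s) / l, by linarith, by linarith⟩ = f y := by
      apply Subtype.ext
      rw [e]
      simp only
      linarith
    have e3 : ((f y : ℝ) - s) / l = y := congrArg Subtype.val (f.injective e2)
    rw [e3] at t1 t2
    rcases hyB with hyB | hyB
    · linarith
    · exact Set.disjoint_left.1 hd ⟨by linarith, t2⟩ hyB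
  rcases image_end hB h hl ha (hap.trans_lt hpb) hb hbB hf with he | ⟨u, huB, hu⟩
  · exact absurd (f y).2.2 (by linarith)
  · rcases hye.lt_or_eq with hlt | heq
    · have h1 := hmax u ⟨huB, hu ▸ hlt⟩
      nlinarith
    · exact hy (heq ▸ heΓ)

/-- The intercepts of the linear pieces lie in `Γ`. -/
theorem exists_piece_mem {ℓ : ℝ} (hℓ : ℓ ∈ D.Γ) {f : Equiv.Perm (Ico (0 : ℝ) ℓ)} {B : Set ℝ}
    (hB : B.Finite) (hBΓ : B ⊆ D.Γ)
    (h : ∀ a b : ℝ, 0 ≤ a → a < b → b ≤ ℓ → Disjoint (Ioo a b) B →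
      ∃ l ∈ D.Λ, ∃ s : ℝ, ∀ t : Ico (0 : ℝ) ℓ, a ≤ t → (t : ℝ) < b → (f t : ℝ) = l * t + s)
    (x : Ico (0 : ℝ) ℓ) : ∃ l ∈ D.Λ, ∃ s ∈ D.Γ, (f x : ℝ) = (l : ℝ) * x + s := by
  obtain ⟨a, b, ha, hax, hxb, hb, haB, hbB, hd, l, hlΛ, s, hf⟩ := exists_piece hB h x
  refine ⟨l, hlΛ, s, ?_, hf x hax hxb⟩
  have h1 := D.value_mem hℓ hB hBΓ h ⟨a, ha, by linarith⟩ haB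
  rw [hf ⟨a, ha, by linarith⟩ le_rfl (by simp only; linarith)] at h1
  have haΓ : a ∈ D.Γ := by
    rcases haB with rfl | haB
    · exact D.Γ.zero_mem
    · exact hBΓ haB
  simpa using D.Γ.sub_mem h1 (D.smul_mem l hlΛ a haΓ)

/-- Stein's group `V(Γ, Λ, ℓ)`: the piecewise linear right continuous bijections of `[0, ℓ)` with
finitely many breakpoints, all in `Γ`, and with slopes in `Λ`. -/
def steinGroup (ℓ : ℝ) (hℓ : ℓ ∈ D.Γ) : Subgroup (Equiv.Perm (Ico (0 : ℝ) ℓ)) where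
  carrier := {f | D.IsPiecewise ℓ f}
  one_mem' := ⟨∅, finite_empty, empty_subset _, fun a b _ _ _ _ =>
    ⟨1, D.Λ.one_mem, 0, fun t _ _ => by simp⟩⟩
  mul_mem' := by
    rintro f g ⟨B, hB, hBΓ, hf⟩ ⟨C, hC, hCΓ, hg⟩
    refine ⟨C ∪ (↑) '' {x : Ico (0 : ℝ) ℓ | (g x : ℝ) ∈ B}, hC.union (Set.Finite.image _ ?_), ?_, ?_⟩
    · exact hB.preimage (Subtype.val_injective.comp g.injective).injOn
    · rintro c (hc | ⟨x, hx, rfl⟩)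
      · exact hCΓ hc
      · obtain ⟨l, hl, s, hs, e⟩ := D.exists_piece_mem hℓ hC hCΓ hg x
        have hx' : (g x : ℝ) ∈ D.Γ := hBΓ hx
        rw [e] at hx'
        exact (D.mul_add_mem_iff ⟨l, hl⟩ ⟨s, hs⟩ x).1 hx'
    · intro a b ha hab hb hd
      rw [Set.disjoint_union_right] at hd
      obtain ⟨l, hl, s, hgs⟩ := hg a b ha hab hb hd.1
      have hl0 : (0 : ℝ) < l := l.2
      have hga := hgs ⟨a, ha, by linarith⟩ le_rfl hab
      have hga0 := (g ⟨a, ha, by linarith⟩).2.1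
      rw [hga] at hga0
      obtain ⟨m, hm, s', hfs⟩ := hf (l * a + s) (l * b + s) hga0 (by nlinarith)
        (image_le hl0 ha hab hb hgs) (by
          rw [Set.disjoint_left]
          rintro c ⟨hc1, hc2⟩ hc
          have t1 : a < (c - s) / l := by rw [lt_div_iff₀ hl0]; linarith
          have t2 : (c - s) / l < b := by rw [div_lt_iff₀ hl0]; linarith
          refine Set.disjoint_left.1 hd.2 ⟨t1, t2⟩ ⟨⟨(c - s) / l, by linarith, by linarith⟩, ?_, rfl⟩
          change ((g ⟨(c - s) / l, _⟩ : Ico (0 : ℝ) ℓ) : ℝ) ∈ B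
          rw [hgs _ t1.le t2]
          simpa [mul_div_cancel₀ _ hl0.ne'] using hc)
      refine ⟨m * l, D.Λ.mul_mem hm hl, m * s + s', fun t h1 h2 => ?_⟩
      have e := hgs t h1 h2
      rw [Equiv.Perm.mul_apply, hfs (g t) (by rw [e]; nlinarith) (by rw [e]; nlinarith), e]
      rw [Positive.val_mul]
      ring
  inv_mem' := by
    rintro f ⟨B, hB, hBΓ, hf⟩
    refine ⟨(fun z : Ico (0 : ℝ) ℓ => (f z : ℝ)) '' {z | (z : ℝ) ∈ insert 0 B},
      Set.Finite.image _ ((hB.insert 0).preimage Subtype.val_injective.injOn), ?_, ?_⟩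
    · rintro _ ⟨z, hz, rfl⟩
      exact D.value_mem hℓ hB hBΓ hf z hz
    · intro c d hc hcd hd hdis
      have hx : (f (f⁻¹ ⟨c, hc, by linarith⟩) : ℝ) = c := by simp
      set x := f⁻¹ ⟨c, hc, by linarith⟩
      obtain ⟨a, b, ha, hax, hxb, hb, haB, hbB, -, l, hlΛ, s, hfs⟩ := exists_piece hB hf x
      have hl0 : (0 : ℝ) < l := l.2
      have hxc := hfs x hax hxb
      have hde : d ≤ l * b + s := by
        rcases image_end hB hf hl0 ha (hax.trans_lt hxb) hb hbB hfs with he | ⟨u, huB, hu⟩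
        · linarith
        · by_contra hlt
          push Not at hlt
          exact Set.disjoint_left.1 hdis ⟨by nlinarith, hlt⟩ ⟨u, huB, hu⟩
      refine ⟨l⁻¹, D.Λ.inv_mem hlΛ, -((l : ℝ)⁻¹ * s), fun u h1 h2 => ?_⟩
      have c1 : (l : ℝ) * (((u : ℝ) - s) / l) = u - s := mul_div_cancel₀ _ hl0.ne'
      have t1 : (x : ℝ) ≤ ((u : ℝ) - s) / l := by rw [le_div_iff₀ hl0]; linarith
      have t2 : ((u : ℝ) - s) / l < b := by rw [div_lt_iff₀ hl0]; linarith
      have t0 := x.2.1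
      have e : f ⟨((u : ℝ) - s) / l, by linarith, by linarith⟩ = u := by
        apply Subtype.ext
        rw [hfs _ (by simp only; linarith) t2]
        simp only
        linarith
      have e2 : f⁻¹ u = ⟨((u : ℝ) - s) / l, by linarith, by linarith⟩ := by
        rw [Equiv.Perm.inv_eq_iff_eq, e]
      rw [e2]
      simp only [Positive.coe_inv]
      ring

/-- The subgroup of `V(Γ, Λ, ℓ)` of the order preserving maps. -/
def steinGroupF (ℓ : ℝ) (hℓ : ℓ ∈ D.Γ) : Subgroup (D.steinGroup ℓ hℓ) where
  carrier := {f | Monotone (f : Equiv.Perm (Ico (0 : ℝ) ℓ))}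
  one_mem' := monotone_id
  mul_mem' := fun hf hg => hf.comp hg
  inv_mem' := by
    intro f hf x y hxy
    by_contra hlt
    push Not at hlt
    have h1 := hf hlt.le
    have h2 : x = y := le_antisymm hxy (by simpa using h1)
    simp [h2] at hlt

/-- The pair `Γ = ℤ[λ, λ⁻¹]`, `Λ = ⟨λ⟩`, for `λ > 1`. -/
noncomputable def ofReal (lam : ℝ) (h : 1 < lam) : SteinPair where
  Γ := (Algebra.adjoin ℤ {lam, lam⁻¹}).toSubring.toAddSubgroup
  Λ := Subgroup.zpowers ⟨lam, one_pos.trans h⟩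
  countable_Γ := by
    change ((Algebra.adjoin ℤ {lam, lam⁻¹} : Subalgebra ℤ ℝ) : Set ℝ).Countable
    rw [Algebra.adjoin_eq_range]
    have : Countable (MvPolynomial ({lam, lam⁻¹} : Set ℝ) ℤ) := by
      rw [← Cardinal.mk_le_aleph0_iff]
      exact MvPolynomial.cardinalMk_le_max.trans (by simp)
    exact Set.countable_range _
  countable_Λ := Set.countable_range _
  smul_mem := by
    rintro _ ⟨n, rfl⟩ t ht
    change _ ∈ Algebra.adjoin ℤ {lam, lam⁻¹}
    change t ∈ Algebra.adjoin ℤ {lam, lam⁻¹} at ht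
    refine mul_mem ?_ ht
    have h1 : lam ∈ Algebra.adjoin ℤ {lam, lam⁻¹} := Algebra.subset_adjoin (by simp)
    have h2 : lam⁻¹ ∈ Algebra.adjoin ℤ {lam, lam⁻¹} := Algebra.subset_adjoin (by simp)
    obtain ⟨k, rfl | rfl⟩ := n.eq_nat_or_neg
    · simpa using pow_mem h1 k
    · simpa using pow_mem h2 k
  dense_Γ := by
    apply AddSubgroup.dense_of_not_isolated_zero
    intro ε hε
    obtain ⟨n, hn⟩ := exists_pow_lt_of_lt_one hε (inv_lt_one_of_one_lt₀ h)
    have h2 : lam⁻¹ ∈ Algebra.adjoin ℤ {lam, lam⁻¹} := Algebra.subset_adjoin (by simp)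
    exact ⟨lam⁻¹ ^ n, pow_mem h2 n, pow_pos (inv_pos.2 (one_pos.trans h)) n, hn⟩

theorem one_mem_ofReal (lam : ℝ) (h : 1 < lam) : (1 : ℝ) ∈ (ofReal lam h).Γ :=
  one_mem (Algebra.adjoin ℤ {lam, lam⁻¹})

theorem one_lt_golden : (1 : ℝ) < (√5 + 1) / 2 := by
  have : (1 : ℝ) < √5 := Real.lt_sqrt_of_sq_lt (by norm_num)
  linarith

/-- The pair defining `𝒮_2`. -/
noncomputable abbrev two : SteinPair := ofReal 2 one_lt_two

/-- The pair defining `𝒮_β`, where `β = (√5 + 1) / 2`. -/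
noncomputable abbrev golden : SteinPair := ofReal ((√5 + 1) / 2) one_lt_golden

/-- The group `V_{λ,1}`. -/
noncomputable abbrev V (lam : ℝ) (h : 1 < lam) : Subgroup (Equiv.Perm (Ico (0 : ℝ) 1)) :=
  (ofReal lam h).steinGroup 1 (one_mem_ofReal lam h)

/-- The group `F_{λ,1}`, as a subgroup of `V_{λ,1}`. -/
noncomputable abbrev F (lam : ℝ) (h : 1 < lam) : Subgroup (V lam h) :=
  (ofReal lam h).steinGroupF 1 (one_mem_ofReal lam h)

end SteinPair

end Stein

/-! The two groupoids are related through one homeomorphism `h` of the line, de Rham's function with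
parameter `p = 1/β`, extended to commute with integer translations. On `[0, 1]` it satisfies `h (x /
2) = p * h x` and `h ((1 + x) / 2) = p + (1 - p) * h x`. Since `β² = β + 1`, also `1 - p = 1/β²`, so
both slopes are powers of `β`. Iterating, `h` on any standard dyadic interval is an affine copy,
with slope in `⟨β⟩` and intercept in `ℤ[β]`, of `h` on `[0, 1]` (`deRham_dyadic`,
`exists_conjugator`).

This has two consequences. Dyadic numbers go into `ℤ[β]`, and a Galois conjugation argument
(`golden_descent`) shows that nothing else does, so `h` lifts to an order isomorphism `ψ` of the
split lines. Moreover, a map `t ↦ 2 ^ k * t + s` with `s` dyadic carries small standard dyadic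
intervals onto standard dyadic intervals, so conjugation by `h` makes it affine, of the golden type,
on each of them (`eventually_conj_affine`). In the split line every point is interior to such an
interval, so this determines a germ of the golden action at every point.

Affine maps are determined by their germs. Hence passing to conjugate germs is a well defined,
locally constant and multiplicative operation, which gives `Ψ` (`exists_openEmbedding`); `Φ` is its
restriction. The group embeddings are conjugation by `h` on `[0, 1)` (`isPiecewise_conj`). -/

namespace Stein

/-! ### De Rham's function -/

/-- The iterates, starting from the identity, whose limit on `[0, 1]` is de Rham's function. -/
noncomputable def deRhamIter (p : ℝ) : ℕ → ℝ → ℝ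
  | 0, x => x
  | n + 1, x =>
    if x ≤ 1 / 2 then p * deRhamIter p n (2 * x) else p + (1 - p) * deRhamIter p n (2 * x - 1)

section deRham

variable {p : ℝ}

theorem deRhamIter_zero (p : ℝ) (n : ℕ) : deRhamIter p n 0 = 0 := by
  induction n with
  | zero => rfl
  | succ n ih => simp [deRhamIter, ih]

theorem deRhamIter_one (p : ℝ) (n : ℕ) : deRhamIter p n 1 = 1 := by
  induction n with
  | zero => rfl
  | succ n ih =>
    have h1 : ¬ (1 : ℝ) ≤ 1 / 2 := by norm_num
    have h2 : (2 * 1 - 1 : ℝ) = 1 := by norm_num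
    simp only [deRhamIter, h1, if_false, h2, ih]
    ring

theorem deRhamIter_left (p : ℝ) (n : ℕ) {x : ℝ} (hx : x ≤ 1) :
    deRhamIter p (n + 1) (x / 2) = p * deRhamIter p n x := by
  have h1 : x / 2 ≤ 1 / 2 := by linarith
  have h2 : 2 * (x / 2) = x := by ring
  simp only [deRhamIter, h1, if_true, h2]

theorem deRhamIter_right (p : ℝ) (n : ℕ) {x : ℝ} (hx : 0 ≤ x) :
    deRhamIter p (n + 1) ((1 + x) / 2) = p + (1 - p) * deRhamIter p n x := by
  -- At `x = 0` the argument `1 / 2` falls into the left branch; the two branches agree there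
  -- because the iterates fix `0` and `1`.
  rcases hx.eq_or_lt with rfl | hx
  · rw [add_zero, deRhamIter_left p n le_rfl, deRhamIter_one, deRhamIter_zero]
    ring
  · have h1 : ¬ (1 + x) / 2 ≤ 1 / 2 := by linarith
    have h2 : 2 * ((1 + x) / 2) - 1 = x := by ring
    simp only [deRhamIter, h1, if_false, h2]

/-- A point of `[0, 1]` lies in the left or in the right half. -/
theorem half_cases {P : ℝ → Prop} (hl : ∀ x ∈ Icc (0 : ℝ) 1, P (x / 2))
    (hr : ∀ x ∈ Icc (0 : ℝ) 1, P ((1 + x) / 2)) : ∀ x ∈ Icc (0 : ℝ) 1, P x := by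
  rintro x ⟨h0, h1⟩
  rcases le_total x (1 / 2) with h | h
  · have := hl (2 * x) ⟨by linarith, by linarith⟩
    rwa [mul_div_cancel_left₀ _ two_ne_zero] at this
  · have := hr (2 * x - 1) ⟨by linarith, by linarith⟩
    rwa [add_sub_cancel, mul_div_cancel_left₀ _ two_ne_zero] at this

theorem deRhamIter_monotoneOn (hp : p ∈ Icc (0 : ℝ) 1) (n : ℕ) :
    MonotoneOn (deRhamIter p n) (Icc 0 1) := by
  induction n with
  | zero => exact monotone_id.monotoneOn _
  | succ n ih =>
    have hle : ∀ x ∈ Icc (0 : ℝ) 1, deRhamIter p n x ≤ 1 := fun x hx => by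
      simpa [deRhamIter_one] using ih hx (right_mem_Icc.2 zero_le_one) hx.2
    have hge : ∀ x ∈ Icc (0 : ℝ) 1, 0 ≤ deRhamIter p n x := fun x hx => by
      simpa [deRhamIter_zero] using ih (left_mem_Icc.2 zero_le_one) hx hx.1
    have hp' : 0 ≤ 1 - p := sub_nonneg.2 hp.2
    intro x hx y hy
    revert y
    refine half_cases (P := fun x => ∀ y, y ∈ Icc (0 : ℝ) 1 → x ≤ y →
      deRhamIter p (n + 1) x ≤ deRhamIter p (n + 1) y) ?_ ?_ x hx
    · intro x hx
      refine half_cases ?_ ?_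
      · intro y hy hxy
        rw [deRhamIter_left p n hx.2, deRhamIter_left p n hy.2]
        exact mul_le_mul_of_nonneg_left (ih hx hy (by linarith)) hp.1
      · intro y hy hxy
        rw [deRhamIter_left p n hx.2, deRhamIter_right p n hy.1]
        have h1 := mul_le_mul_of_nonneg_left (hle x hx) hp.1
        have h2 := mul_nonneg hp' (hge y hy)
        linarith
    · intro x hx
      refine half_cases ?_ ?_
      · intro y hy hxy
        -- A point of the right half is below a point of the left half only if both are `1 / 2`.
        have hx0 : x = 0 := by linarith [hx.1, hy.2]
        have hy1 : y = 1 := by linarith [hx.1, hy.2]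
        subst hx0 hy1
        simp
      · intro y hy hxy
        rw [deRhamIter_right p n hx.1, deRhamIter_right p n hy.1]
        have := mul_le_mul_of_nonneg_left (ih hx hy (by linarith)) hp'
        linarith

/-- The recursion contracts distances by `p` or `1 - p`, so consecutive iterates approach each other
geometrically. The factor `1` matches the form `C * r ^ n` expected by `cauchySeq_of_le_geometric`.
-/
theorem deRhamIter_dist (hp : p ∈ Icc (0 : ℝ) 1) (n : ℕ) :
    ∀ x ∈ Icc (0 : ℝ) 1,
      dist (deRhamIter p n x) (deRhamIter p (n + 1) x) ≤ 1 * max p (1 - p) ^ n := by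
  induction n with
  | zero =>
    intro x hx
    have h := deRhamIter_monotoneOn hp 1
    have h0 := h (left_mem_Icc.2 zero_le_one) hx hx.1
    have h1 := h hx (right_mem_Icc.2 zero_le_one) hx.2
    rw [deRhamIter_zero] at h0
    rw [deRhamIter_one] at h1
    rw [Real.dist_eq, abs_le]
    change -_ ≤ x - _ ∧ x - _ ≤ _
    simp only [pow_zero, zero_add]
    constructor <;> linarith [hx.1, hx.2]
  | succ n ih =>
    have hr : 0 ≤ max p (1 - p) := hp.1.trans (le_max_left _ _)
    refine half_cases ?_ ?_
    · intro x hx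
      have := ih x hx
      rw [deRhamIter_left p n hx.2, deRhamIter_left p (n + 1) hx.2, Real.dist_eq, ← mul_sub,
        abs_mul, abs_of_nonneg hp.1, pow_succ']
      rw [Real.dist_eq] at this
      calc p * _ ≤ max p (1 - p) * (1 * max p (1 - p) ^ n) :=
            mul_le_mul (le_max_left _ _) this (abs_nonneg _) hr
        _ = _ := by ring
    · intro x hx
      have := ih x hx
      rw [deRhamIter_right p n hx.1, deRhamIter_right p (n + 1) hx.1, Real.dist_eq,
        add_sub_add_left_eq_sub, ← mul_sub, abs_mul, abs_of_nonneg (sub_nonneg.2 hp.2), pow_succ']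
      rw [Real.dist_eq] at this
      calc (1 - p) * _ ≤ max p (1 - p) * (1 * max p (1 - p) ^ n) :=
            mul_le_mul (le_max_right _ _) this (abs_nonneg _) hr
        _ = _ := by ring

/-- Existence of de Rham's function on `[0, 1]`. -/
theorem exists_deRham (hp : p ∈ Ioo (0 : ℝ) 1) :
    ∃ g : ℝ → ℝ, MonotoneOn g (Icc 0 1) ∧ g 0 = 0 ∧ g 1 = 1 ∧
      (∀ x ∈ Icc (0 : ℝ) 1, g (x / 2) = p * g x) ∧
      ∀ x ∈ Icc (0 : ℝ) 1, g ((1 + x) / 2) = p + (1 - p) * g x := by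
  have hp' : p ∈ Icc (0 : ℝ) 1 := ⟨hp.1.le, hp.2.le⟩
  have hr : max p (1 - p) < 1 := max_lt hp.2 (by linarith [hp.1])
  -- The membership sits under the existential so that `choose` yields a function on all of `ℝ`; its
  -- values off `[0, 1]` are irrelevant.
  have hlim : ∀ x : ℝ, ∃ y : ℝ, x ∈ Icc (0 : ℝ) 1 →
      Filter.Tendsto (fun n => deRhamIter p n x) Filter.atTop (𝓝 y) := by
    intro x
    by_cases hx : x ∈ Icc (0 : ℝ) 1
    · obtain ⟨y, hy⟩ := cauchySeq_tendsto_of_complete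
        (cauchySeq_of_le_geometric _ _ hr fun n => deRhamIter_dist hp' n x hx)
      exact ⟨y, fun _ => hy⟩
    · exact ⟨0, fun h => absurd h hx⟩
  choose g hg using hlim
  have h0 : (0 : ℝ) ∈ Icc (0 : ℝ) 1 := left_mem_Icc.2 zero_le_one
  have h1 : (1 : ℝ) ∈ Icc (0 : ℝ) 1 := right_mem_Icc.2 zero_le_one
  refine ⟨g, ?_, ?_, ?_, ?_, ?_⟩
  · intro x hx y hy hxy
    exact le_of_tendsto_of_tendsto' (hg x hx) (hg y hy)
      fun n => deRhamIter_monotoneOn hp' n hx hy hxy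
  · exact tendsto_nhds_unique (hg 0 h0) (by simp [deRhamIter_zero])
  · exact tendsto_nhds_unique (hg 1 h1) (by simp [deRhamIter_one])
  · intro x hx
    have h := (hg (x / 2) ⟨by linarith [hx.1], by linarith [hx.2]⟩).comp
      (Filter.tendsto_add_atTop_nat 1)
    refine tendsto_nhds_unique h (((hg x hx).const_mul p).congr fun n => ?_)
    exact (deRhamIter_left p n hx.2).symm
  · intro x hx
    have h := (hg ((1 + x) / 2) ⟨by linarith [hx.1], by linarith [hx.2]⟩).comp
      (Filter.tendsto_add_atTop_nat 1)
    refine tendsto_nhds_unique h ((((hg x hx).const_mul (1 - p)).const_add p).congr fun n => ?_)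
    exact (deRhamIter_right p n hx.1).symm

/-- On every dyadic interval de Rham's function is an affine image of itself. -/
theorem deRham_dyadic {h : ℝ → ℝ}
    (hint : ∀ (m : ℤ), ∀ x ∈ Icc (0 : ℝ) 1, h (m + x) = m + h x)
    (hl : ∀ x ∈ Icc (0 : ℝ) 1, h (x / 2) = p * h x)
    (hr : ∀ x ∈ Icc (0 : ℝ) 1, h ((1 + x) / 2) = p + (1 - p) * h x) (n : ℕ) (m : ℤ) :
    ∃ i j : ℕ, ∃ s ∈ Subring.closure {p}, ∀ x ∈ Icc (0 : ℝ) 1,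
      h ((m + x) / 2 ^ n) = p ^ i * (1 - p) ^ j * h x + s := by
  have hpc : p ∈ Subring.closure {p} := Subring.subset_closure rfl
  induction n generalizing m with
  | zero => exact ⟨0, 0, m, intCast_mem _ m, fun x hx => by simpa [add_comm] using hint m x hx⟩
  | succ n ih =>
    -- The interval of index `m` at level `n + 1` is the left or right half, by the parity of `m`,
    -- of the interval of index `m / 2` (integer division) at level `n`.
    obtain ⟨i, j, s, hs, e⟩ := ih (m / 2)
    have hcoef : p ^ i * (1 - p) ^ j ∈ Subring.closure {p} :=
      mul_mem (pow_mem hpc i) (pow_mem (sub_mem (one_mem _) hpc) j)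
    rcases Int.emod_two_eq_zero_or_one m with hm | hm
    · have hm' : (m : ℝ) = 2 * ((m / 2 : ℤ) : ℝ) := by
        exact_mod_cast (by omega : m = 2 * (m / 2))
      refine ⟨i + 1, j, s, hs, fun x hx => ?_⟩
      have := e (x / 2) ⟨by linarith [hx.1], by linarith [hx.2]⟩
      rw [hl x hx] at this
      rw [show (m + x) / 2 ^ (n + 1) = (((m / 2 : ℤ) : ℝ) + x / 2) / 2 ^ n by
        rw [pow_succ, hm']; field_simp, this]
      ring
    · have hm' : (m : ℝ) = 2 * ((m / 2 : ℤ) : ℝ) + 1 := by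
        exact_mod_cast (by omega : m = 2 * (m / 2) + 1)
      refine ⟨i, j + 1, p ^ i * (1 - p) ^ j * p + s, add_mem (mul_mem hcoef hpc) hs, fun x hx => ?_⟩
      have := e ((1 + x) / 2) ⟨by linarith [hx.1], by linarith [hx.2]⟩
      rw [hr x hx] at this
      rw [show (m + x) / 2 ^ (n + 1) = (((m / 2 : ℤ) : ℝ) + (1 + x) / 2) / 2 ^ n by
        rw [pow_succ, hm']; field_simp; ring, this]
      ring

/-- The extension of de Rham's function to an order automorphism of the line that commutes with
integer translations. -/
theorem exists_deRham_orderIso (hp : p ∈ Ioo (0 : ℝ) 1) :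
    ∃ h : ℝ ≃o ℝ, (∀ (m : ℤ) (x : ℝ), h (m + x) = m + h x) ∧ h 0 = 0 ∧
      (∀ x ∈ Icc (0 : ℝ) 1, h (x / 2) = p * h x) ∧
      ∀ x ∈ Icc (0 : ℝ) 1, h ((1 + x) / 2) = p + (1 - p) * h x := by
  obtain ⟨g, hmono, g0, g1, gl, gr⟩ := exists_deRham hp
  have hp1 : 0 < 1 - p := sub_pos.2 hp.2
  have h0 : (0 : ℝ) ∈ Icc (0 : ℝ) 1 := left_mem_Icc.2 zero_le_one
  have h1 : (1 : ℝ) ∈ Icc (0 : ℝ) 1 := right_mem_Icc.2 zero_le_one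
  have hfr : ∀ x : ℝ, Int.fract x ∈ Icc (0 : ℝ) 1 :=
    fun x => ⟨Int.fract_nonneg x, (Int.fract_lt_one x).le⟩
  obtain ⟨h, hdef⟩ : ∃ h : ℝ → ℝ, ∀ x, h x = ⌊x⌋ + g (Int.fract x) := ⟨_, fun _ => rfl⟩
  have hg : ∀ x ∈ Icc (0 : ℝ) 1, h x = g x := by
    intro x hx
    rcases hx.2.eq_or_lt with rfl | hx1
    · simp [hdef, g0, g1]
    · have : ⌊x⌋ = 0 := Int.floor_eq_zero_iff.2 ⟨hx.1, hx1⟩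
      rw [hdef, Int.fract, this]
      simp
  have hint : ∀ (m : ℤ) (x : ℝ), h (m + x) = m + h x := by
    intro m x
    rw [hdef, hdef, Int.floor_intCast_add, Int.fract_intCast_add]
    push_cast
    ring
  have hl : ∀ x ∈ Icc (0 : ℝ) 1, h (x / 2) = p * h x := by
    intro x hx
    rw [hg x hx, hg _ ⟨by linarith [hx.1], by linarith [hx.2]⟩, gl x hx]
  have hr : ∀ x ∈ Icc (0 : ℝ) 1, h ((1 + x) / 2) = p + (1 - p) * h x := by
    intro x hx
    rw [hg x hx, hg _ ⟨by linarith [hx.1], by linarith [hx.2]⟩, gr x hx]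
  have g_nonneg : ∀ x ∈ Icc (0 : ℝ) 1, 0 ≤ g x := fun x hx => g0 ▸ hmono h0 hx hx.1
  have g_le : ∀ x ∈ Icc (0 : ℝ) 1, g x ≤ 1 := fun x hx => g1 ▸ hmono hx h1 hx.2
  have mono : Monotone h := by
    intro x y hxy
    rw [hdef, hdef]
    rcases (Int.floor_mono hxy).eq_or_lt with e | hlt
    · have : Int.fract x ≤ Int.fract y := by
        rw [Int.fract, Int.fract, e]
        linarith
      rw [e]
      linarith [hmono (hfr x) (hfr y) this]
    · have : (⌊x⌋ : ℝ) + 1 ≤ ⌊y⌋ := by exact_mod_cast hlt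
      linarith [g_le _ (hfr x), g_nonneg _ (hfr y)]
  have strict : StrictMono h := by
    refine mono.strictMono_of_injective ?_
    intro x y hxy
    by_contra hne
    wlog hlt : x < y generalizing x y
    · exact this hxy.symm (Ne.symm hne) (lt_of_le_of_ne (not_lt.1 hlt) (Ne.symm hne))
    -- Two mesh lengths fit between `x` and `y`, so a whole dyadic interval does, even after
    -- rounding up. Over it `h` increases by `p ^ i * (1 - p) ^ j > 0`.
    obtain ⟨n, hn⟩ := exists_pow_lt_of_lt_one (half_pos (sub_pos.2 hlt))
      (show (2⁻¹ : ℝ) < 1 by norm_num)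
    have h2n : (0 : ℝ) < 2 ^ n := by positivity
    rw [inv_pow, inv_lt_iff_one_lt_mul₀ h2n] at hn
    obtain ⟨i, j, s, -, e⟩ := deRham_dyadic (fun m x _ => hint m x) hl hr n ⌈x * 2 ^ n⌉
    have e0 := e 0 h0
    have e1 := e 1 h1
    rw [hg 0 h0, g0] at e0
    rw [hg 1 h1, g1] at e1
    have hc : 0 < p ^ i * (1 - p) ^ j := mul_pos (pow_pos hp.1 i) (pow_pos hp1 j)
    have m0 : h x ≤ h ((⌈x * 2 ^ n⌉ + 0) / 2 ^ n) := mono (by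
      rw [le_div_iff₀ h2n, add_zero]
      exact Int.le_ceil _)
    have m1 : h ((⌈x * 2 ^ n⌉ + 1) / 2 ^ n) ≤ h y := mono (by
      rw [div_le_iff₀ h2n]
      have := Int.ceil_lt_add_one (x * 2 ^ n)
      nlinarith)
    linarith
  -- To approximate `y`, rescale the half `[0, p]` or `[p, 1]` containing it to `[0, 1]`,
  -- approximate there, and map back by a contraction.
  have dense_aux : ∀ n : ℕ, ∀ y ∈ Icc (0 : ℝ) 1, ∃ x ∈ Icc (0 : ℝ) 1,
      |h x - y| ≤ max p (1 - p) ^ n := by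
    intro n
    induction n with
    | zero =>
      intro y hy
      exact ⟨0, h0, by
        rw [hg 0 h0, g0, zero_sub, abs_neg, abs_of_nonneg hy.1, pow_zero]; exact hy.2⟩
    | succ n ih =>
      intro y hy
      have hm : 0 ≤ max p (1 - p) := hp.1.le.trans (le_max_left _ _)
      rcases le_total y p with hyp | hyp
      · obtain ⟨x, hx, e⟩ := ih (y / p) ⟨div_nonneg hy.1 hp.1.le, (div_le_one hp.1).2 hyp⟩
        refine ⟨x / 2, ⟨by linarith [hx.1], by linarith [hx.2]⟩, ?_⟩
        have : h (x / 2) - y = p * (h x - y / p) := by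
          rw [hl x hx, mul_sub, mul_div_cancel₀ _ hp.1.ne']
        rw [this, abs_mul, abs_of_pos hp.1, pow_succ']
        exact mul_le_mul (le_max_left _ _) e (abs_nonneg _) hm
      · obtain ⟨x, hx, e⟩ := ih ((y - p) / (1 - p))
          ⟨div_nonneg (by linarith) hp1.le, (div_le_one hp1).2 (by linarith [hy.2])⟩
        refine ⟨(1 + x) / 2, ⟨by linarith [hx.1], by linarith [hx.2]⟩, ?_⟩
        have : h ((1 + x) / 2) - y = (1 - p) * (h x - (y - p) / (1 - p)) := by
          rw [hr x hx, mul_sub, mul_div_cancel₀ _ hp1.ne']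
          ring
        rw [this, abs_mul, abs_of_pos hp1, pow_succ']
        exact mul_le_mul (le_max_right _ _) e (abs_nonneg _) hm
  have dense : DenseRange h := by
    intro y
    rw [Metric.mem_closure_range_iff]
    intro ε hε
    obtain ⟨n, hn⟩ := exists_pow_lt_of_lt_one hε
      (max_lt hp.2 (by linarith [hp.1]) : max p (1 - p) < 1)
    obtain ⟨x, -, e⟩ := dense_aux n _ (hfr y)
    refine ⟨⌊y⌋ + x, ?_⟩
    rw [hint, Real.dist_eq, abs_sub_comm]
    have : (⌊y⌋ : ℝ) + h x - y = h x - Int.fract y := by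
      rw [Int.fract]
      ring
    rw [this]
    exact e.trans_lt hn
  -- A monotone function with dense range has no jumps.
  have cont : Continuous h := mono.continuous_of_denseRange dense
  have hlow : ∀ x, x - 1 ≤ h x := fun x => by
    rw [hdef]
    linarith [g_nonneg _ (hfr x), Int.lt_floor_add_one x]
  have hup : ∀ x, h x ≤ x + 1 := fun x => by
    rw [hdef]
    linarith [g_le _ (hfr x), Int.floor_le x]
  have surj : Function.Surjective h := cont.surjective
    (Filter.tendsto_atTop_mono hlow (Filter.tendsto_atTop_add_const_right _ _ Filter.tendsto_id))
    (Filter.tendsto_atBot_mono hup (Filter.tendsto_atBot_add_const_right _ _ Filter.tendsto_id))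
  exact ⟨StrictMono.orderIsoOfSurjective h strict surj, hint, by
    change h 0 = 0
    rw [hg 0 h0, g0], hl, hr⟩

end deRham

end Stein

namespace Stein

/-! ### The golden ratio -/

namespace SteinPair

theorem mem_two_iff {x : ℝ} : x ∈ two.Γ ↔ ∃ (n : ℕ) (m : ℤ), x = m / 2 ^ n := by
  change x ∈ Algebra.adjoin ℤ {2, 2⁻¹} ↔ _
  constructor
  · intro hx
    induction hx using Algebra.adjoin_induction with
    | mem x hx =>
      rcases hx with rfl | rfl
      · exact ⟨0, 2, by simp⟩
      · exact ⟨1, 1, by simp⟩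
    | algebraMap r => exact ⟨0, r, by simp⟩
    | add x y _ _ hx hy =>
      obtain ⟨n, m, rfl⟩ := hx
      obtain ⟨n', m', rfl⟩ := hy
      refine ⟨n + n', m * 2 ^ n' + m' * 2 ^ n, ?_⟩
      push_cast
      rw [pow_add]
      field_simp
    | mul x y _ _ hx hy =>
      obtain ⟨n, m, rfl⟩ := hx
      obtain ⟨n', m', rfl⟩ := hy
      refine ⟨n + n', m * m', ?_⟩
      push_cast
      rw [pow_add]
      field_simp
  · rintro ⟨n, m, rfl⟩
    rw [div_eq_mul_inv, ← inv_pow]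
    exact mul_mem (intCast_mem _ m) (pow_mem (Algebra.subset_adjoin (by simp)) n)

theorem dyadic_mem (n : ℕ) (m : ℤ) : (m : ℝ) / 2 ^ n ∈ two.Γ := mem_two_iff.2 ⟨n, m, rfl⟩

theorem golden_mul_self : ((√5 + 1) / 2 : ℝ) * ((√5 + 1) / 2) = (√5 + 1) / 2 + 1 := by
  have : √5 * √5 = 5 := Real.mul_self_sqrt (by norm_num)
  linarith

theorem golden_inv : ((√5 + 1) / 2 : ℝ)⁻¹ = (√5 + 1) / 2 - 1 := by
  have h := golden_mul_self
  exact inv_eq_of_mul_eq_one_right (by linarith)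

/-- `β` is a unit of `ℤ + ℤβ`, with inverse `β - 1`. The coordinates `a`, `b` give access to the
Galois conjugate `a - b / β`. -/
theorem mem_golden_iff {y : ℝ} : y ∈ golden.Γ ↔ ∃ a b : ℤ, y = a + b * ((√5 + 1) / 2) := by
  change y ∈ Algebra.adjoin ℤ {(√5 + 1) / 2, ((√5 + 1) / 2)⁻¹} ↔ _
  constructor
  · intro hy
    induction hy using Algebra.adjoin_induction with
    | mem x hx =>
      rcases hx with rfl | rfl
      · exact ⟨0, 1, by simp⟩
      · exact ⟨-1, 1, by rw [golden_inv]; push_cast; ring⟩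
    | algebraMap r => exact ⟨r, 0, by simp⟩
    | add x y _ _ hx hy =>
      obtain ⟨a, b, rfl⟩ := hx
      obtain ⟨c, d, rfl⟩ := hy
      exact ⟨a + c, b + d, by push_cast; ring⟩
    | mul x y _ _ hx hy =>
      obtain ⟨a, b, rfl⟩ := hx
      obtain ⟨c, d, rfl⟩ := hy
      refine ⟨a * c + b * d, a * d + b * c + b * d, ?_⟩
      push_cast
      linear_combination (b * d : ℝ) * golden_mul_self
  · rintro ⟨a, b, rfl⟩
    exact add_mem (intCast_mem _ a)
      (mul_mem (intCast_mem _ b) (Algebra.subset_adjoin (mem_insert _ _)))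

theorem two_add_mem_iff (m : ℤ) {x : ℝ} : m + x ∈ two.Γ ↔ x ∈ two.Γ :=
  two.Γ.add_mem_cancel_left (by simpa using dyadic_mem 0 m)

theorem two_div_two_mem {x : ℝ} (hx : x ∈ two.Γ) : x / 2 ∈ two.Γ := by
  obtain ⟨n, m, rfl⟩ := mem_two_iff.1 hx
  rw [div_div, ← pow_succ]
  exact dyadic_mem _ _

/-- Every element of `ℤ[β] ∩ [0, 1)` has a finite expansion: its orbit under the expanding map
that is conjugate to the doubling map ends at `0`, since the Galois conjugates of the elements of
the orbit approach `[-1, 1]`. -/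
theorem golden_descent {h : ℝ ≃o ℝ} (h0 : h 0 = 0) (h1 : h 1 = 1)
    (hl : ∀ x ∈ Icc (0 : ℝ) 1, h (x / 2) = ((√5 + 1) / 2)⁻¹ * h x)
    (hr : ∀ x ∈ Icc (0 : ℝ) 1,
      h ((1 + x) / 2) = ((√5 + 1) / 2)⁻¹ + (1 - ((√5 + 1) / 2)⁻¹) * h x) (n : ℕ) :
    ∀ x ∈ Ico (0 : ℝ) 1, ∀ a b : ℤ, h x = a + b * ((√5 + 1) / 2) →
      |a - b * ((√5 + 1) / 2)⁻¹| ≤ 1 + ((√5 + 1) / 2) ^ n / 5 → x ∈ two.Γ := by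
  have hsq := golden_mul_self
  have hβ1 := one_lt_golden
  have hβ2 : (1.6 : ℝ) < (√5 + 1) / 2 := by
    have : (2.2 : ℝ) < √5 := Real.lt_sqrt_of_sq_lt (by norm_num)
    linarith
  rw [golden_inv] at *
  -- From here on only `β² = β + 1` and `β > 1.6` are used, with `β⁻¹` written as `β - 1`.
  generalize ((√5 + 1) / 2 : ℝ) = β at *
  induction n with
  | zero =>
    intro x hx a b e hab
    have e0 : 0 ≤ h x := h0 ▸ h.monotone hx.1
    have e1 : h x < 1 := h1 ▸ h.strictMono hx.2
    rw [abs_le, pow_zero] at hab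
    -- The difference between `h x` and its conjugate is `b * (2β - 1)`. It lies in `[-1.2, 2.2)`,
    -- while `2β - 1 > 2.2`; the `1 / 5` in the bound is small enough for this.
    have hb : b = 0 := by
      have u : (b : ℝ) < 1 := by nlinarith [hab.1]
      have l : (-1 : ℝ) < b := by nlinarith [hab.2]
      have u' : b < 1 := by exact_mod_cast u
      have l' : -1 < b := by exact_mod_cast l
      omega
    subst hb
    have ha : a = 0 := by
      have u : (a : ℝ) < 1 := by simpa [e] using e1
      have l : (0 : ℝ) ≤ a := by simpa [e] using e0
      have u' : a < 1 := by exact_mod_cast u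
      have l' : 0 ≤ a := by exact_mod_cast l
      omega
    subst ha
    have : x = 0 := h.injective (by rw [e, h0]; simp)
    exact this ▸ two.Γ.zero_mem
  | succ n ih =>
    intro x hx a b e hab
    rw [pow_succ, abs_le] at hab
    have hpow : 0 < β ^ n := pow_pos (by linarith) n
    have hinv : (β - 1) * β = 1 := by linarith
    rcases lt_or_ge x (1 / 2) with hlt | hge
    · have key := hl (2 * x) ⟨by linarith [hx.1], by linarith⟩
      rw [mul_div_cancel_left₀ _ two_ne_zero] at key
      -- Here `h (2 * x) = β * h x`, with coordinates `b` and `a + b`; the conjugate gets multiplied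
      -- by `-1/β`.
      have hd := ih (2 * x) ⟨by linarith [hx.1], by linarith⟩ b (a + b)
        (by push_cast; linear_combination β * e - β * key - (h (2 * x) - b) * hsq) (by
          have : (b : ℝ) - ((a + b : ℤ) : ℝ) * (β - 1) = -((β - 1) * (a - b * (β - 1))) := by
            push_cast
            linear_combination (-b : ℝ) * hsq
          rw [this, abs_neg, abs_mul, abs_of_pos (sub_pos.2 hβ1)]
          have := mul_le_mul_of_nonneg_left (abs_le.2 hab) (sub_pos.2 hβ1).le
          have t : (β - 1) * (1 + β ^ n * β / 5) = β - 1 + β ^ n / 5 := by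
            linear_combination β ^ n / 5 * hinv
          nlinarith)
      simpa using two_div_two_mem hd
    · have key := hr (2 * x - 1) ⟨by linarith, by linarith [hx.2]⟩
      rw [add_sub_cancel, mul_div_cancel_left₀ _ two_ne_zero] at key
      -- Here `h (2 * x - 1) = β² * h x - β`, and the conjugate `c` becomes `c / β² + 1 / β`. As `1
      -- / β² + 1 / β = 1`, the constant `1` in the bound is reproduced.
      have hd := ih (2 * x - 1) ⟨by linarith, by linarith [hx.2]⟩ (a + b) (a + 2 * b - 1)
        (by
          push_cast
          linear_combination (1 + β) * e - (1 + β) * key + (h (2 * x - 1) - 1 + b) * hsq) (by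
          have : ((a + b : ℤ) : ℝ) - ((a + 2 * b - 1 : ℤ) : ℝ) * (β - 1)
              = (2 - β) * (a - b * (β - 1)) + (β - 1) := by
            push_cast
            linear_combination (-b : ℝ) * hsq
          have hβ3 : β < 2 := by nlinarith
          have t : (2 - β) * (1 + β ^ n * β / 5) = 2 - β + (β - 1) * β ^ n / 5 := by
            linear_combination - (β ^ n / 5) * hsq
          have u1 := mul_le_mul_of_nonneg_left hab.1 (sub_pos.2 hβ3).le
          have u2 := mul_le_mul_of_nonneg_left hab.2 (sub_pos.2 hβ3).le
          have u3 : (β - 1) * β ^ n ≤ β ^ n := by nlinarith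
          rw [this, abs_le]
          constructor <;> nlinarith)
      have h2 := two_div_two_mem ((two_add_mem_iff 1).2 hd)
      push_cast at h2
      rwa [add_sub_cancel, mul_div_cancel_left₀ _ two_ne_zero] at h2

/-- There is an order automorphism of the line that maps `ℤ[1/2]` onto `ℤ[β]` and whose
restrictions to all standard dyadic intervals are affinely equivalent. -/
theorem exists_conjugator : ∃ h : ℝ ≃o ℝ, h 0 = 0 ∧ h 1 = 1 ∧
    (∀ x, h x ∈ golden.Γ ↔ x ∈ two.Γ) ∧
    ∀ (n : ℕ) (m : ℤ), ∃ l ∈ golden.Λ, ∃ s ∈ golden.Γ, ∀ x ∈ Icc (0 : ℝ) 1,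
      h ((m + x) / 2 ^ n) = l * h x + s := by
  have hβ := one_lt_golden
  have hp : ((√5 + 1) / 2 : ℝ)⁻¹ ∈ Ioo (0 : ℝ) 1 :=
    ⟨inv_pos.2 (one_pos.trans hβ), inv_lt_one_of_one_lt₀ hβ⟩
  obtain ⟨h, hint, h0, hl, hr⟩ := exists_deRham_orderIso hp
  have h1 : h 1 = 1 := by simpa [h0] using hint 1 0
  have hK : ∀ (n : ℕ) (m : ℤ), ∃ l ∈ golden.Λ, ∃ s ∈ golden.Γ, ∀ x ∈ Icc (0 : ℝ) 1,
      h ((m + x) / 2 ^ n) = l * h x + s := by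
    intro n m
    obtain ⟨i, j, s, hs, e⟩ := deRham_dyadic (fun m x _ => hint m x) hl hr n m
    have hsub : Subring.closure {((√5 + 1) / 2 : ℝ)⁻¹}
        ≤ (Algebra.adjoin ℤ {(√5 + 1) / 2, ((√5 + 1) / 2)⁻¹}).toSubring :=
      Subring.closure_le.2 (singleton_subset_iff.2 (Algebra.subset_adjoin (by simp)))
    refine ⟨(⟨(√5 + 1) / 2, one_pos.trans hβ⟩⁻¹ : PosReal) ^ (i + 2 * j),
      pow_mem (inv_mem (Subgroup.mem_zpowers _)) _, s, hsub hs, fun x hx => ?_⟩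
    rw [e x hx, Positive.val_pow, Positive.coe_inv, pow_add, pow_mul]
    have : 1 - ((√5 + 1) / 2 : ℝ)⁻¹ = ((√5 + 1) / 2 : ℝ)⁻¹ ^ 2 := by
      rw [golden_inv]
      linear_combination - golden_mul_self
    rw [this]
  refine ⟨h, h0, h1, fun x => ⟨fun hx => ?_, fun hx => ?_⟩, hK⟩
  · rw [← Int.floor_add_fract x, two_add_mem_iff]
    rw [← Int.floor_add_fract x, hint] at hx
    obtain ⟨a, b, e⟩ := mem_golden_iff.1 hx
    -- The number of descent steps is chosen from the size of the conjugate of `h (Int.fract x)`.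
    obtain ⟨n, hn⟩ := pow_unbounded_of_one_lt
      (5 * |((a - ⌊x⌋ : ℤ) : ℝ) - b * ((√5 + 1) / 2)⁻¹|) hβ
    refine golden_descent h0 h1 hl hr n _ ⟨Int.fract_nonneg x, Int.fract_lt_one x⟩
      (a - ⌊x⌋) b ?_ (by linarith)
    push_cast
    linarith
  · obtain ⟨n, m, rfl⟩ := mem_two_iff.1 hx
    obtain ⟨l, -, s, hs, e⟩ := hK n m
    have := e 0 (left_mem_Icc.2 zero_le_one)
    rw [add_zero, h0, mul_zero, zero_add] at this
    rwa [this]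

/-- Affine maps in `Γ ⋊ Λ` of the dyadic pair are conjugated to affine maps on all sufficiently
small standard dyadic intervals. -/
theorem eventually_conj_affine {h : ℝ ≃o ℝ}
    (hK : ∀ (n : ℕ) (m : ℤ), ∃ l ∈ golden.Λ, ∃ s ∈ golden.Γ, ∀ x ∈ Icc (0 : ℝ) 1,
      h ((m + x) / 2 ^ n) = l * h x + s) {l : PosReal} (hl : l ∈ two.Λ) {s : ℝ} (hs : s ∈ two.Γ) :
    ∀ᶠ n : ℕ in Filter.atTop, ∀ m : ℤ, ∃ l' ∈ golden.Λ, ∃ s' ∈ golden.Γ,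
      ∀ t ∈ Icc ((m : ℝ) / 2 ^ n) ((m + 1) / 2 ^ n), h (l * t + s) = l' * h t + s' := by
  obtain ⟨k, rfl⟩ := hl
  obtain ⟨r, c, rfl⟩ := mem_two_iff.1 hs
  filter_upwards [Filter.eventually_ge_atTop (k.natAbs + r)] with n hn m
  -- The map `t ↦ 2 ^ k * t + c / 2 ^ r` sends the interval of index `m` at level `n` onto the one
  -- of index `m + c * 2 ^ d` at level `n - k = r + d`. On both, `h` is an affine copy of `h` on
  -- `[0, 1]`; comparing the copies gives slope `l₂ / l₁`.
  obtain ⟨N, hN⟩ : ∃ N : ℕ, (N : ℤ) = n - k := ⟨(n - k).toNat, by omega⟩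
  obtain ⟨d, rfl⟩ : ∃ d, N = r + d := ⟨N - r, by omega⟩
  obtain ⟨l₁, hl₁, s₁, hs₁, e₁⟩ := hK n m
  obtain ⟨l₂, hl₂, s₂, hs₂, e₂⟩ := hK (r + d) (m + c * 2 ^ d)
  refine ⟨l₂ * l₁⁻¹, mul_mem hl₂ (inv_mem hl₁), s₂ - (l₂ * l₁⁻¹ : PosReal) * s₁,
    golden.Γ.sub_mem hs₂ (golden.smul_mem _ (mul_mem hl₂ (inv_mem hl₁)) _ hs₁), fun t ht => ?_⟩
  have h2n : (0 : ℝ) < 2 ^ n := by positivity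
  have hx : t * 2 ^ n - m ∈ Icc (0 : ℝ) 1 := by
    have t1 := (div_le_iff₀ h2n).1 ht.1
    have t2 := (le_div_iff₀ h2n).1 ht.2
    exact ⟨by linarith, by linarith⟩
  have f₁ := e₁ _ hx
  have f₂ := e₂ _ hx
  rw [show ((m : ℝ) + (t * 2 ^ n - m)) / 2 ^ n = t by field_simp; ring] at f₁
  have hk : (2 : ℝ) ^ n = 2 ^ (r + d) * (2 : ℝ) ^ k := by
    rw [← zpow_natCast, ← zpow_natCast, ← zpow_add₀ two_ne_zero, hN, sub_add_cancel]
  have ht' : (((m + c * 2 ^ d : ℤ) : ℝ) + (t * 2 ^ n - m)) / 2 ^ (r + d)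
      = (2 : ℝ) ^ k * t + c / 2 ^ r := by
    rw [hk]
    push_cast
    rw [pow_add]
    field_simp
    ring
  have hcoe : (((⟨2, one_pos.trans one_lt_two⟩ : PosReal) ^ k : PosReal) : ℝ) = 2 ^ k :=
    Positive.coe_zpow _ _
  rw [ht'] at f₂
  have hl0 : (l₁ : ℝ) ≠ 0 := l₁.2.ne'
  change h (((⟨2, one_pos.trans one_lt_two⟩ : PosReal) ^ k : PosReal) * t + _) = _
  rw [hcoe, f₂, f₁, Positive.val_mul, Positive.coe_inv]
  field_simp
  ring

end SteinPair

end Stein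

namespace Stein

/-! ### Homomorphisms of transformation groupoids induced by local conjugacies -/

namespace TransformationGroupoid

variable {X Y G H : Type*} [TopologicalSpace X] [TopologicalSpace Y]

/-- As `G` is discrete, the arrow space is the disjoint union of open slices, copies of `X` indexed
by `G`. -/
theorem isOpen_iff {S : Set (TransformationGroupoid X G)} :
    IsOpen S ↔ ∀ γ : G, IsOpen {x : X | (⟨x, γ⟩ : TransformationGroupoid X G) ∈ S} := by
  let _ : TopologicalSpace G := ⊥
  have : DiscreteTopology G := ⟨rfl⟩
  constructor
  · rintro ⟨O, hO, rfl⟩ γ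
    exact hO.preimage (by fun_prop : Continuous fun x : X => (x, γ))
  · intro hS
    refine ⟨⋃ γ : G, {x : X | (⟨x, γ⟩ : TransformationGroupoid X G) ∈ S} ×ˢ {γ},
      isOpen_iUnion fun γ => (hS γ).prod (isOpen_discrete _), ?_⟩
    ext ⟨x, γ⟩
    simp

variable [Group G] [Group H] [MulAction G X] [MulAction H Y]

/-- A homeomorphism that conjugates a topologically free action locally into another one induces an
open embedding of the transformation groupoids. -/
theorem exists_openEmbedding (ψ : X ≃ₜ Y) (contG : ∀ γ : G, Continuous fun x : X => γ • x)
    (freeG : ∀ (γ γ' : G) (x : X), (∀ᶠ z in 𝓝 x, γ • z = γ' • z) → γ = γ')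
    (freeH : ∀ (δ δ' : H) (y : Y), (∀ᶠ z in 𝓝 y, δ • z = δ' • z) → δ = δ')
    (germ : ∀ (γ : G) (x : X), ∃ δ : H, ∀ᶠ z in 𝓝 x, ψ (γ • z) = δ • ψ z) :
    ∃ Ψ : TransformationGroupoid X G → TransformationGroupoid Y H,
      IsOpenGroupoidEmbedding Ψ ∧ (∀ x, Ψ (unit x) = unit (ψ x)) ∧
      ∀ g, (Ψ g).pt = ψ g.pt ∧ (Ψ g).elt⁻¹ • (Ψ g).pt = ψ (g.elt⁻¹ • g.pt) := by
  have uniq : ∀ (δ δ' : H) (x : X), (∀ᶠ z in 𝓝 x, δ • ψ z = δ' • ψ z) → δ = δ' := by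
    intro δ δ' x hx
    refine freeH δ δ' (ψ x) ?_
    rw [← ψ.map_nhds_eq]
    exact hx
  -- Inverses appear because the arrow `(x, γ)` goes from `γ⁻¹ • x` to `x`; the germ must be taken
  -- at the range `x`.
  have germ' : ∀ (γ : G) (x : X), ∃ δ : H, ∀ᶠ z in 𝓝 x, ψ (γ⁻¹ • z) = δ⁻¹ • ψ z := by
    intro γ x
    obtain ⟨δ, hδ⟩ := germ γ⁻¹ x
    exact ⟨δ⁻¹, by simpa using hδ⟩
  choose d hd using germ'
  have hd_eq : ∀ γ x δ, (∀ᶠ z in 𝓝 x, ψ (γ⁻¹ • z) = δ⁻¹ • ψ z) → d γ x = δ := by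
    intro γ x δ h
    refine inv_injective (uniq _ _ x ?_)
    filter_upwards [h, hd γ x] with z h1 h2
    rw [← h1, ← h2]
  -- The relation defining `d γ x` persists at nearby points, and germs determine elements of `H`.
  -- Local constancy yields both continuity and openness of `Ψ`.
  have hd_const : ∀ γ x, ∀ᶠ z in 𝓝 x, d γ z = d γ x := by
    intro γ x
    filter_upwards [eventually_eventually_nhds.2 (hd γ x)] with z hz
    exact hd_eq _ _ _ hz
  have hpt : ∀ γ x, (d γ x)⁻¹ • ψ x = ψ (γ⁻¹ • x) := fun γ x => (hd γ x).self_of_nhds.symm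
  refine ⟨fun g => ⟨ψ g.pt, d g.elt g.pt⟩, ⟨?_, ?_, ?_, ?_⟩, ?_, fun g => ⟨rfl, hpt _ _⟩⟩
  · rintro ⟨x, γ⟩ ⟨x', γ'⟩ e
    have e' : γ⁻¹ • x = x' := congrArg TransformationGroupoid.pt e
    subst e'
    refine ⟨congrArg unit (hpt γ x), ?_⟩
    refine TransformationGroupoid.ext rfl ?_
    change d (γ * γ') x = d γ x * d γ' (γ⁻¹ • x)
    refine hd_eq _ _ _ ?_
    filter_upwards [hd γ x, (contG γ⁻¹).continuousAt.eventually (hd γ' (γ⁻¹ • x))] with z h1 h2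
    rw [mul_inv_rev, mul_smul, h2, h1, mul_inv_rev, mul_smul]
  · rw [continuous_def]
    intro S hS
    rw [isOpen_iff] at hS ⊢
    intro γ
    rw [isOpen_iff_mem_nhds]
    intro x hx
    filter_upwards [hd_const γ x,
      ψ.continuous.continuousAt.eventually ((hS (d γ x)).mem_nhds hx)] with z h1 h2
    change (⟨ψ z, d γ z⟩ : TransformationGroupoid Y H) ∈ S
    rw [h1]
    exact h2
  · rintro ⟨x, γ⟩ ⟨x', γ'⟩ e
    have e₁ : x = x' := ψ.injective (congrArg TransformationGroupoid.pt e)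
    subst e₁
    have e₂ : d γ x = d γ' x := congrArg TransformationGroupoid.elt e
    refine TransformationGroupoid.ext rfl (inv_injective (freeG _ _ x ?_))
    filter_upwards [hd γ x, hd γ' x] with z h1 h2
    rw [e₂, ← h2] at h1
    exact ψ.injective h1
  · intro S hS
    rw [isOpen_iff] at hS ⊢
    intro δ
    rw [isOpen_iff_mem_nhds]
    rintro _ ⟨⟨x, γ⟩, hx, e⟩
    obtain ⟨rfl, rfl⟩ := TransformationGroupoid.mk.inj e
    change _ ∈ 𝓝 (ψ x)
    rw [← ψ.map_nhds_eq, Filter.mem_map]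
    filter_upwards [hd_const γ x, (hS γ).mem_nhds hx] with z h1 h2
    exact ⟨⟨z, γ⟩, h2, TransformationGroupoid.ext rfl h1⟩
  · intro x
    exact TransformationGroupoid.ext rfl (hd_eq _ _ _ (Filter.Eventually.of_forall fun z => by
      change ψ ((1 : G)⁻¹ • z) = (1 : H)⁻¹ • ψ z
      simp))

/-- Open embeddings of transformation groupoids restrict to reductions. -/
theorem exists_reduction_openEmbedding {ψ : X → Y}
    {Ψ : TransformationGroupoid X G → TransformationGroupoid Y H} (hΨ : IsOpenGroupoidEmbedding Ψ)
    (hpt : ∀ g, (Ψ g).pt = ψ g.pt ∧ (Ψ g).elt⁻¹ • (Ψ g).pt = ψ (g.elt⁻¹ • g.pt))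
    {A : Set X} {B : Set Y} (hAB : ∀ x, ψ x ∈ B ↔ x ∈ A) :
    ∃ Φ : Reduction G A → Reduction H B, IsOpenGroupoidEmbedding Φ ∧ ∀ g, Ψ g.1 = (Φ g).1 := by
  -- The equivalence, not just one implication, gives openness: the image of the trace of `O` is the
  -- trace of `Ψ '' O`.
  have hmem : ∀ g, ((Ψ g).pt ∈ B ∧ (Ψ g).elt⁻¹ • (Ψ g).pt ∈ B)
      ↔ (g.pt ∈ A ∧ g.elt⁻¹ • g.pt ∈ A) := fun g => by
    rw [(hpt g).2, (hpt g).1, hAB, hAB]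
  refine ⟨fun g => ⟨Ψ g.1, (hmem g.1).2 g.2⟩, ⟨?_, ?_, ?_, ?_⟩, fun _ => rfl⟩
  · intro g h e
    obtain ⟨e', he⟩ := hΨ.hom g.1 h.1 (congrArg Subtype.val e)
    exact ⟨Subtype.ext e', Subtype.ext he⟩
  · exact (hΨ.continuous.comp continuous_subtype_val).subtype_mk _
  · intro g h e
    exact Subtype.ext (hΨ.injective (congrArg Subtype.val e))
  · rintro _ ⟨O, hO, rfl⟩
    refine ⟨Ψ '' O, hΨ.isOpenMap O hO, ?_⟩
    ext k
    constructor
    · rintro ⟨g, hg, e⟩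
      have hk := k.2
      rw [← e] at hk
      exact ⟨⟨g, (hmem g).1 hk⟩, hg, Subtype.ext e⟩
    · rintro ⟨g, hg, rfl⟩
      exact ⟨g.1, hg, rfl⟩

end TransformationGroupoid

/-! ### The split line -/

namespace SplitReal

variable {Δ Δ' : Set ℝ}

theorem lt_iff {x y : SplitReal Δ} : x < y ↔ x.q < y.q ∨ x.q = y.q ∧ x.side < y.side :=
  Prod.Lex.lt_iff (x := x.1) (y := y.1)

theorem q_le {x y : SplitReal Δ} (h : x ≤ y) : x.q ≤ y.q := by
  rcases h.eq_or_lt with rfl | h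
  · exact le_rfl
  · rcases lt_iff.1 h with h | h
    · exact h.le
    · exact h.1.le

theorem lt_of_q_lt {x y : SplitReal Δ} (h : x.q < y.q) : x < y := lt_iff.2 (Or.inl h)

/-- The order isomorphism of split lines induced by an order automorphism of the line. -/
def congrOrderIso (h : ℝ ≃o ℝ) (hΔ : ∀ x, h x ∈ Δ' ↔ x ∈ Δ) : SplitReal Δ ≃o SplitReal Δ' where
  toFun x := mk (h x.q) x.side ((hΔ x.q).trans x.mem_iff)
  invFun y := mk (h.symm y.q) y.side
    (((hΔ _).symm.trans (by rw [h.apply_symm_apply])).trans y.mem_iff)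
  left_inv x := SplitReal.ext (h.symm_apply_apply x.q) rfl
  right_inv y := SplitReal.ext (h.apply_symm_apply y.q) rfl
  map_rel_iff' {x y} := by
    refine not_lt.symm.trans ((not_congr (lt_iff.trans ?_)).trans not_lt)
    rw [lt_iff (x := y)]
    change h y.q < h x.q ∨ h y.q = h x.q ∧ y.side < x.side ↔ _
    rw [h.lt_iff_lt, h.injective.eq_iff]

theorem congrOrderIso_right (h : ℝ ≃o ℝ) (hΔ : ∀ x, h x ∈ Δ' ↔ x ∈ Δ) (t : ℝ) :
    congrOrderIso h hΔ (right Δ t) = right Δ' (h t) := by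
  refine SplitReal.ext rfl ?_
  classical
  change (if t ∈ Δ then (1 : SignType) else 0) = if h t ∈ Δ' then 1 else 0
  simp only [hΔ]

/-- A neighbourhood of a point of the split line contains all points over some open interval. -/
theorem exists_Ioo_of_eventually {x : SplitReal Δ} {P : SplitReal Δ → Prop}
    (hP : ∀ᶠ z in 𝓝 x, P z) : ∃ a b : ℝ, a < b ∧ ∀ z : SplitReal Δ, z.q ∈ Ioo a b → P z := by
  obtain ⟨l, u, ⟨hl, hu⟩, h⟩ := (mem_nhds_iff_exists_Ioo_subset'
    ⟨right Δ (x.q - 1), lt_of_q_lt (sub_one_lt x.q)⟩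
    ⟨right Δ (x.q + 1), lt_of_q_lt (lt_add_one x.q)⟩).1 hP
  -- The interval found lies on one side of `x`. One side is always available: otherwise `l < x < u`
  -- would be three points over one real number.
  rcases lt_iff.1 hl with h1 | ⟨h1, s1⟩
  · exact ⟨l.q, x.q, h1, fun z hz => h ⟨lt_of_q_lt hz.1, (lt_of_q_lt hz.2).trans hu⟩⟩
  rcases lt_iff.1 hu with h2 | ⟨h2, s2⟩
  · exact ⟨x.q, u.q, h2, fun z hz => h ⟨hl.trans (lt_of_q_lt hz.1), lt_of_q_lt hz.2⟩⟩
  exfalso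
  have key : ∀ a b c : SignType, a < b → b < c → b = 0 ∧ a ≠ 0 := by decide
  obtain ⟨k1, k2⟩ := key _ _ _ s1 s2
  exact x.mem_iff.not_left.2 k1 (h1 ▸ l.mem_iff.2 k2)

end SplitReal

/-! ### The affine action on the split line and its germs -/

namespace SteinPair

variable {D : SteinPair}

theorem q_smul (γ : D.Aff) (x : D.Line) :
    (γ • x).q = (γ.right.1 : ℝ) * x.q + (γ.left.toAdd : D.Γ) := rfl

theorem side_smul (γ : D.Aff) (x : D.Line) : (γ • x).side = x.side := rfl

theorem continuous_smul_line (γ : D.Aff) : Continuous fun x : D.Line => γ • x := by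
  have h : StrictMono fun x : D.Line => γ • x := by
    intro x y hxy
    have hl : (0 : ℝ) < γ.right.1 := γ.right.1.2
    rw [SplitReal.lt_iff, q_smul, q_smul, side_smul, side_smul]
    rcases SplitReal.lt_iff.1 hxy with h | ⟨h, hs⟩
    · exact Or.inl (by gcongr)
    · exact Or.inr ⟨by rw [h], hs⟩
  exact (h.orderIsoOfSurjective _ (MulAction.surjective γ)).continuous

/-- Topological freeness of the action: affine maps that agree at two distinct reals coincide. -/
theorem eq_of_eventually_smul_eq (γ γ' : D.Aff) (x : D.Line)
    (h : ∀ᶠ z in 𝓝 x, γ • z = γ' • z) : γ = γ' := by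
  obtain ⟨a, b, hab, h⟩ := SplitReal.exists_Ioo_of_eventually h
  have key : ∀ t ∈ Ioo a b, (γ.right.1 : ℝ) * t + (γ.left.toAdd : D.Γ)
      = (γ'.right.1 : ℝ) * t + (γ'.left.toAdd : D.Γ) :=
    fun t ht => congrArg SplitReal.q (h (SplitReal.right _ t) ht)
  obtain ⟨c, hac, hcb⟩ := exists_between hab
  obtain ⟨d, hcd, hdb⟩ := exists_between hcb
  have k1 := key c ⟨hac, hcb⟩
  have k2 := key d ⟨hac.trans hcd, hdb⟩
  have k3 : (γ.right.1 : ℝ) = γ'.right.1 := by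
    have : ((γ.right.1 : ℝ) - γ'.right.1) * (d - c) = 0 := by linear_combination k2 - k1
    exact sub_eq_zero.1 ((mul_eq_zero.1 this).resolve_right (sub_pos.2 hcd).ne')
  refine SemidirectProduct.ext ?_ (Subtype.ext (Subtype.ext k3))
  apply Multiplicative.toAdd.injective
  apply Subtype.ext
  rw [k3] at k1
  exact add_left_cancel k1

/-- Every point of the dyadic split line is interior to a standard dyadic interval of level `n`. -/
theorem exists_dyadic_interval (n : ℕ) (x : two.Line) :
    ∃ m : ℤ, ∀ᶠ z in 𝓝 x, SplitReal.q z ∈ Icc ((m : ℝ) / 2 ^ n) ((m + 1) / 2 ^ n) := by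
  have h2n : (0 : ℝ) < 2 ^ n := by positivity
  suffices H : ∃ m : ℤ, SplitReal.minus _ (dyadic_mem n m) < x ∧
      x < SplitReal.plus _ (dyadic_mem n (m + 1)) by
    obtain ⟨m, h1, h2⟩ := H
    refine ⟨m, ?_⟩
    filter_upwards [Ioo_mem_nhds h1 h2] with z hz
    have z1 : (m : ℝ) / 2 ^ n ≤ z.q := SplitReal.q_le hz.1.le
    have z2 : z.q ≤ ((m + 1 : ℤ) : ℝ) / 2 ^ n := SplitReal.q_le hz.2.le
    push_cast at z2
    exact ⟨z1, z2⟩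
  -- A point `t₋` belongs to the dyadic interval ending at `t`, hence the ceiling; any other point
  -- takes the floor. In the split line the bounds `(m / 2 ^ n)₋` and `((m + 1) / 2 ^ n)₊` are
  -- strict even at the end points.
  by_cases hs : x.side = -1
  · refine ⟨⌈x.q * 2 ^ n⌉ - 1, SplitReal.lt_of_q_lt ?_, SplitReal.lt_iff.2 ?_⟩
    · change ((⌈x.q * 2 ^ n⌉ - 1 : ℤ) : ℝ) / 2 ^ n < x.q
      rw [div_lt_iff₀ h2n]
      push_cast
      linarith [Int.ceil_lt_add_one (x.q * 2 ^ n)]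
    · change x.q < ((⌈x.q * 2 ^ n⌉ - 1 + 1 : ℤ) : ℝ) / 2 ^ n
        ∨ x.q = ((⌈x.q * 2 ^ n⌉ - 1 + 1 : ℤ) : ℝ) / 2 ^ n ∧ x.side < 1
      have hle : x.q ≤ ((⌈x.q * 2 ^ n⌉ - 1 + 1 : ℤ) : ℝ) / 2 ^ n := by
        rw [le_div_iff₀ h2n, sub_add_cancel]
        exact Int.le_ceil _
      exact hle.lt_or_eq.imp_right fun e => ⟨e, by rw [hs]; decide⟩
  · refine ⟨⌊x.q * 2 ^ n⌋, SplitReal.lt_iff.2 ?_, SplitReal.lt_of_q_lt ?_⟩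
    · change (⌊x.q * 2 ^ n⌋ : ℝ) / 2 ^ n < x.q
        ∨ (⌊x.q * 2 ^ n⌋ : ℝ) / 2 ^ n = x.q ∧ -1 < x.side
      have hle : (⌊x.q * 2 ^ n⌋ : ℝ) / 2 ^ n ≤ x.q := by
        rw [div_le_iff₀ h2n]
        exact Int.floor_le _
      have key : ∀ a : SignType, a ≠ -1 → -1 < a := by decide
      exact hle.lt_or_eq.imp_right fun e => ⟨e, key _ hs⟩
    · change x.q < ((⌊x.q * 2 ^ n⌋ + 1 : ℤ) : ℝ) / 2 ^ n
      rw [lt_div_iff₀ h2n]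
      push_cast
      exact Int.lt_floor_add_one _

/-- Supplies the local conjugacy required by `exists_openEmbedding`: a neighbourhood of `x` lies
over a single dyadic interval fine enough for `eventually_conj_affine`. -/
theorem exists_germ {h : ℝ ≃o ℝ} (hΓ : ∀ x, h x ∈ (golden.Γ : Set ℝ) ↔ x ∈ (two.Γ : Set ℝ))
    (hK : ∀ (n : ℕ) (m : ℤ), ∃ l ∈ golden.Λ, ∃ s ∈ golden.Γ, ∀ x ∈ Icc (0 : ℝ) 1,
      h ((m + x) / 2 ^ n) = l * h x + s) (γ : two.Aff) (x : two.Line) :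
    ∃ δ : golden.Aff, ∀ᶠ z in 𝓝 x,
      SplitReal.congrOrderIso h hΓ (γ • z) = δ • SplitReal.congrOrderIso h hΓ z := by
  obtain ⟨n, hn⟩ := (eventually_conj_affine hK γ.right.2 γ.left.toAdd.2).exists
  obtain ⟨m, hm⟩ := exists_dyadic_interval n x
  obtain ⟨l, hl, s, hs, e⟩ := hn m
  refine ⟨⟨Multiplicative.ofAdd ⟨s, hs⟩, ⟨l, hl⟩⟩, ?_⟩
  filter_upwards [hm] with z hz
  exact SplitReal.ext (e z.q hz) rfl

/-! ### Conjugation of the Stein groups -/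

/-- The conjugate of a dyadic piecewise linear bijection is piecewise linear. -/
theorem isPiecewise_conj {h : ℝ ≃o ℝ} (h0 : h 0 = 0) (h1 : h 1 = 1)
    (hΓ : ∀ x, h x ∈ golden.Γ ↔ x ∈ two.Γ)
    (hK : ∀ (n : ℕ) (m : ℤ), ∃ l ∈ golden.Λ, ∃ s ∈ golden.Γ, ∀ x ∈ Icc (0 : ℝ) 1,
      h ((m + x) / 2 ^ n) = l * h x + s)
    {f : Equiv.Perm (Ico (0 : ℝ) 1)} (hf : two.IsPiecewise 1 f)
    {g : Ico (0 : ℝ) 1 → Ico (0 : ℝ) 1}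
    (hg : ∀ x y : Ico (0 : ℝ) 1, (y : ℝ) = h x → (g y : ℝ) = h (f x)) :
    golden.IsPiecewise 1 g := by
  obtain ⟨B, hB, hBΓ, hf⟩ := hf
  have one_mem : (1 : ℝ) ∈ two.Γ := one_mem_ofReal _ _
  have hΓ0 : ∀ c ∈ insert 0 B, c ∈ two.Γ := by
    rintro c (rfl | hc)
    · exact two.Γ.zero_mem
    · exact hBΓ hc
  have hΓ1 : ∀ c ∈ insert 1 B, c ∈ two.Γ := by
    rintro c (rfl | hc)
    · exact one_mem
    · exact hBΓ hc
  have hlevel : ∀ c ∈ two.Γ, ∀ᶠ n : ℕ in Filter.atTop, ∃ i : ℤ, c * 2 ^ n = i := by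
    intro c hc
    obtain ⟨r, i, rfl⟩ := mem_two_iff.1 hc
    filter_upwards [Filter.eventually_ge_atTop r] with n hn
    obtain ⟨k, rfl⟩ := Nat.exists_eq_add_of_le hn
    refine ⟨i * 2 ^ k, ?_⟩
    push_cast
    rw [pow_add]
    field_simp
  -- The conditions on `a` and `b` stand inside the eventual statement, so that one `n` can serve
  -- all the finitely many pairs of end points.
  have hpieces : ∀ a ∈ insert 0 B, ∀ b ∈ insert 1 B, ∀ᶠ n : ℕ in Filter.atTop,
      0 ≤ a → a < b → b ≤ 1 → Disjoint (Ioo a b) B → ∀ m : ℤ,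
        ∃ l ∈ golden.Λ, ∃ s : ℝ, ∀ t : Ico (0 : ℝ) 1, a ≤ t → (t : ℝ) < b →
          (t : ℝ) ∈ Icc ((m : ℝ) / 2 ^ n) ((m + 1) / 2 ^ n) → h (f t) = l * h t + s := by
    intro a haB b hbB
    by_cases H : 0 ≤ a ∧ a < b ∧ b ≤ 1 ∧ Disjoint (Ioo a b) B
    · obtain ⟨ha, hab, hb, hd⟩ := H
      obtain ⟨l, hl, s, e⟩ := hf a b ha hab hb hd
      -- `IsPiecewise` leaves the intercept arbitrary; it is dyadic because a bijection takes values
      -- in `Γ` at its breakpoints.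
      have hs : s ∈ two.Γ := by
        have v := two.value_mem one_mem hB hBΓ hf ⟨a, ha, hab.trans_le hb⟩ haB
        rw [e ⟨a, ha, hab.trans_le hb⟩ le_rfl hab] at v
        simpa using two.Γ.sub_mem v (two.smul_mem l hl a (hΓ0 a haB))
      filter_upwards [eventually_conj_affine hK hl hs] with n hn _ _ _ _ m
      obtain ⟨l', hl', s', -, e'⟩ := hn m
      refine ⟨l', hl', s', fun t h1 h2 h3 => ?_⟩
      rw [e t h1 h2, e' t h3]
    · exact Filter.Eventually.of_forall fun n ha hab hb hd => absurd ⟨ha, hab, hb, hd⟩ H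
  obtain ⟨n, hn0, hn1, hn⟩ :=
    (((hB.insert 0).eventually_all.2 fun c hc => hlevel c (hΓ0 c hc)).and
      (((hB.insert 1).eventually_all.2 fun c hc => hlevel c (hΓ1 c hc)).and
        ((hB.insert 0).eventually_all.2 fun a ha =>
          (hB.insert 1).eventually_all.2 fun b hb => hpieces a ha b hb))).exists
  have h2n : (0 : ℝ) < 2 ^ n := by positivity
  -- All level `n` dyadic points are declared breakpoints, carried over by `h`. An interval avoiding
  -- them pulls back into a single dyadic interval, which lies in one linear piece of `f` since the
  -- points of `B` are of level `n`.
  refine ⟨(fun m : ℤ => h (m / 2 ^ n)) '' Icc 0 (2 ^ n), (finite_Icc _ _).image _, ?_, ?_⟩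
  · rintro _ ⟨m, -, rfl⟩
    exact (hΓ _).2 (dyadic_mem n m)
  intro a b ha hab hb hd
  have hx0 : 0 ≤ h.symm a := by
    rw [h.le_symm_apply, h0]
    exact ha
  have hxb : h.symm a < h.symm b := h.symm.strictMono hab
  have hb1 : h.symm b ≤ 1 := by
    rw [h.symm_apply_le, h1]
    exact hb
  have hx1 := hxb.trans_le hb1
  set m : ℤ := ⌊h.symm a * 2 ^ n⌋ with hm
  have hm0 : 0 ≤ m := Int.floor_nonneg.2 (by positivity)
  have hmle : (m : ℝ) / 2 ^ n ≤ h.symm a := by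
    rw [div_le_iff₀ h2n]
    exact Int.floor_le _
  have hmlt : h.symm a < (m + 1) / 2 ^ n := by
    rw [lt_div_iff₀ h2n]
    exact Int.lt_floor_add_one _
  have hbm : h.symm b ≤ (m + 1) / 2 ^ n := by
    by_contra! hlt
    have hm1 : m + 1 ≤ 2 ^ n := by
      have := (div_lt_iff₀ h2n).1 (hlt.trans_le hb1)
      have : ((m + 1 : ℤ) : ℝ) < ((2 ^ n : ℤ) : ℝ) := by
        push_cast
        linarith
      exact (Int.cast_lt.1 this).le
    refine Set.disjoint_left.1 hd ?_ ⟨m + 1, ⟨by omega, hm1⟩, rfl⟩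
    push_cast
    exact ⟨h.symm_apply_lt.1 hmlt, h.lt_symm_apply.1 hlt⟩
  obtain ⟨a', b', ha', hax, hxb', hb', haB, hbB, hd', -⟩ := exists_piece hB hf ⟨_, hx0, hx1⟩
  simp only at hax hxb'
  obtain ⟨l, hl, s, e⟩ := hn a' haB b' hbB ha' (hax.trans_lt hxb') hb' hd' m
  have hmb' : ((m : ℝ) + 1) / 2 ^ n ≤ b' := by
    obtain ⟨j, hj⟩ := hn1 b' hbB
    rw [div_le_iff₀ h2n, hj]
    have : m < j := by
      rw [hm, Int.floor_lt, ← hj]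
      exact mul_lt_mul_of_pos_right hxb' h2n
    exact_mod_cast this
  refine ⟨l, hl, s, fun t hat htb => ?_⟩
  have hxt : h.symm a ≤ h.symm t := h.symm.monotone hat
  have htx : h.symm t < h.symm b := h.symm.strictMono htb
  rw [hg ⟨h.symm t, hx0.trans hxt, htx.trans_le hb1⟩ t (by simp),
    e ⟨h.symm t, hx0.trans hxt, htx.trans_le hb1⟩ (hax.trans hxt) (htx.trans_le (hbm.trans hmb'))
      ⟨hmle.trans hxt, (htx.trans_le hbm).le⟩, h.apply_symm_apply]

end SteinPair

end Stein

/-! ### The embeddings of groupoids and groups -/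

theorem proposition6p3 :
    -- the homomorphism `Φ` of the reductions and its restriction `φ` to the unit spaces
    ∃ (Φ : Stein.SteinPair.two.Reduced 1 (Stein.SteinPair.one_mem_ofReal _ _) →
          Stein.SteinPair.golden.Reduced 1 (Stein.SteinPair.one_mem_ofReal _ _))
      (φ : Stein.SteinPair.two.interval 1 (Stein.SteinPair.one_mem_ofReal _ _) ≃ₜ
          Stein.SteinPair.golden.interval 1 (Stein.SteinPair.one_mem_ofReal _ _)),
      Stein.IsOpenGroupoidEmbedding Φ ∧
      (∀ x, Φ (Stein.TransformationGroupoid.Reduction.unit x)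
        = Stein.TransformationGroupoid.Reduction.unit (φ x)) ∧
      (∀ x y, x < y ↔ φ x < φ y) ∧
      -- the extension `Ψ` of `Φ` to the Stein groupoids and its restriction `ψ` to the unit spaces
      ∃ (Ψ : Stein.SteinPair.two.Groupoid → Stein.SteinPair.golden.Groupoid)
        (ψ : Stein.SteinPair.two.Line ≃ₜ Stein.SteinPair.golden.Line),
        Stein.IsOpenGroupoidEmbedding Ψ ∧
        (∀ x, Ψ (Stein.TransformationGroupoid.unit x)
          = Stein.TransformationGroupoid.unit (ψ x)) ∧
        (∀ x y, x < y ↔ ψ x < ψ y) ∧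
        (∀ g, Ψ g.1 = (Φ g).1) ∧
        -- the induced embeddings of groups, given by conjugation by `ψ`
        ∃ (ι : Stein.SteinPair.V 2 one_lt_two →*
              Stein.SteinPair.V ((√5 + 1) / 2) Stein.SteinPair.one_lt_golden)
          (κ : Stein.SteinPair.F 2 one_lt_two →*
              Stein.SteinPair.F ((√5 + 1) / 2) Stein.SteinPair.one_lt_golden),
          Function.Injective ι ∧
          Function.Injective κ ∧
          (∀ f, (κ f).1 = ι f.1) ∧
          (∀ (f : Stein.SteinPair.V 2 one_lt_two) (x y : Set.Ico (0 : ℝ) 1),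
            ψ (Stein.SplitReal.right _ x) = Stein.SplitReal.right _ y →
            ψ (Stein.SplitReal.right _ (f.1 x)) = Stein.SplitReal.right _ ((ι f).1 y)) := by
  obtain ⟨h, h0, h1, hΓ, hK⟩ := Stein.SteinPair.exists_conjugator
  let ψ : Stein.SteinPair.two.Line ≃o Stein.SteinPair.golden.Line :=
    Stein.SplitReal.congrOrderIso h hΓ
  obtain ⟨Ψ, hΨ, hunit, hpt⟩ := Stein.TransformationGroupoid.exists_openEmbedding
    ψ.toHomeomorph Stein.SteinPair.continuous_smul_line
    Stein.SteinPair.eq_of_eventually_smul_eq Stein.SteinPair.eq_of_eventually_smul_eq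
    (Stein.SteinPair.exists_germ hΓ hK)
  have hint : ∀ x, ψ x ∈ Stein.SteinPair.golden.interval 1 (Stein.SteinPair.one_mem_ofReal _ _)
      ↔ x ∈ Stein.SteinPair.two.interval 1 (Stein.SteinPair.one_mem_ofReal _ _) := by
    intro x
    have e0 : ψ (Stein.SplitReal.plus 0 Stein.SteinPair.two.Γ.zero_mem)
        = Stein.SplitReal.plus 0 Stein.SteinPair.golden.Γ.zero_mem := Stein.SplitReal.ext h0 rfl
    have e1 : ψ (Stein.SplitReal.minus 1 (Stein.SteinPair.one_mem_ofReal _ _))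
        = Stein.SplitReal.minus 1 (Stein.SteinPair.one_mem_ofReal _ _) :=
      Stein.SplitReal.ext h1 rfl
    rw [Stein.SteinPair.interval, Stein.SteinPair.interval, mem_Icc, mem_Icc, ← e0, ← e1,
      ψ.le_iff_le, ψ.le_iff_le]
  obtain ⟨Φ, hΦ, hext⟩ :=
    Stein.TransformationGroupoid.exists_reduction_openEmbedding hΨ hpt hint
  have hIco : ∀ x : ℝ, x ∈ Ico (0 : ℝ) 1 ↔ h x ∈ Ico (0 : ℝ) 1 := by
    intro x
    rw [mem_Ico, mem_Ico, ← h.le_iff_le, ← h.lt_iff_lt (x := x), h0, h1]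
  -- Both `ι` and `κ` are conjugation by this restriction of `h`; its monotonicity in both
  -- directions keeps order preserving maps order preserving.
  let e : Ico (0 : ℝ) 1 ≃ Ico (0 : ℝ) 1 := h.toEquiv.subtypeEquiv hIco
  have he : ∀ x, (e x : ℝ) = h x := fun _ => rfl
  have hmono : Monotone e := fun x y hxy => h.monotone hxy
  have hmono' : Monotone e.symm := fun x y hxy => h.symm.monotone hxy
  let ι : Stein.SteinPair.V 2 one_lt_two →*
      Stein.SteinPair.V ((√5 + 1) / 2) Stein.SteinPair.one_lt_golden :=
    (e.permCongrHom.toMonoidHom.comp (Subgroup.subtype _)).codRestrict _ fun f =>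
      Stein.SteinPair.isPiecewise_conj h0 h1 hΓ hK f.2 fun x y hy => by
        have : e.symm y = x := e.symm_apply_eq.2 (Subtype.ext hy)
        change (e (f.1 (e.symm y)) : ℝ) = _
        rw [this, he]
  have hι : ∀ f y, (ι f).1 y = e (f.1 (e.symm y)) := fun _ _ => rfl
  have ι_inj : Function.Injective ι := fun f g hfg =>
    Subtype.ext (e.permCongrHom.injective (congrArg Subtype.val hfg))
  let κ : Stein.SteinPair.F 2 one_lt_two →*
      Stein.SteinPair.F ((√5 + 1) / 2) Stein.SteinPair.one_lt_golden :=
    (ι.comp (Subgroup.subtype _)).codRestrict _ fun f => hmono.comp (f.2.comp hmono')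
  refine ⟨Φ, ψ.toHomeomorph.subtype fun x => (hint x).symm, hΦ, fun x => Subtype.ext ?_,
    fun x y => (ψ.lt_iff_lt (x := x.1) (y := y.1)).symm, Ψ, ψ.toHomeomorph, hΨ, hunit,
    fun x y => ψ.lt_iff_lt.symm, hext, ι, κ, ι_inj, fun f g hfg => ?_, fun _ => rfl, ?_⟩
  · rw [← hext]
    exact hunit x
  · exact Subtype.ext (ι_inj (congrArg Subtype.val hfg))
  · intro f x y hxy
    have hxy' : h x = y := congrArg Stein.SplitReal.q hxy
    have hex : e.symm y = x := e.symm_apply_eq.2 (Subtype.ext hxy'.symm)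
    rw [hι, hex, he]
    exact Stein.SplitReal.congrOrderIso_right h hΓ _
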